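/- Let $m\ge 6$ be even and let $D_3(m)$ be the directed torus with vertex set $V=(\mathbb Z/m\mathbb Z)^3$ and arcs $v\to v+e_d$, $d\in\{0,1,2\}$, where $e_0=(1,0,0)$, $e_1=(0,1,0)$, $e_2=(0,0,1)$. For $v=(i,j,k)\in V$ put $S(v)=i+j+k\in\mathbb Z/m\mathbb Z$; all coordinates are read modulo $m$. Define the \emph{Route E} assignment, which gives to every $v$ a triple $\delta(v)=(d_0(v),d_1(v),d_2(v))$ of directions, one for each color $0,1,2$, as follows. If $S(v)\notin\{0,1,2\}$, then $\delta(v)=(0,1,2)$. If $S(v)=1$, then $\delta(v)=(1,0,2)$ when $i=0$ and $\delta(v)=(2,0,1)$ when $i\neq0$. If $S(v)=2$, then $\delta(v)=(2,1,0)$ when $j=0$ and $\delta(v)=(0,1,2)$ when $j\ne0$. If $S(v)=0$ and $m\equiv 0,2\pmod 6$, let \begin{align*} X_{102}&=\{(0,0,0)\}\cup\{(i,1,m-1-i):1\le i\le m-3\}\cup\{(m-1,2,m-1)\},\\ X_{021}&=\{(0,1,m-1)\}\cup\{(i,m-i,0):1\le i\le m-3\}\cup\{(m-1,0,1)\},\\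 X_{210}&=\{(0,j,m-j):2\le j\le m-1\}\cup\{(1,0,m-1)\}, \end{align*} and let $\delta(v)$ be $(1,0,2)$, $(0,2,1)$, $(2,1,0)$ for $v$ in $X_{102}$, $X_{021}$, $X_{210}$ respectively, $(0,1,2)$ for $v=(m-2,1,1)$, $(2,0,1)$ for $v=(m-2,2,0)$, and $(1,2,0)$ for all other $v$ with $S(v)=0$. If $S(v)=0$ and $m\equiv 4\pmod 6$, let \begin{align*} Y_{102}&=\{(0,0,0)\}\cup\{(i,1,m-1-i):2\le i\le m-3\}\cup\{(m-1,2,m-1)\},\\ Y_{021}&=\{(0,1,m-1)\}\cup\{(i,m-i,0):2\le i\le m-3\}\cup\{(m-1,0,1)\},\\ Y_{210}&=\{(0,j,m-j):2\le j\le m-1\}\cup\{(1,0,m-1)\}\\ &\quad\cup\{(1,j,m-1-j):2\le j\le m-2\}\cup\{(2,0,m-2),(2,m-1,m-1)\}, \end{align*} and let $\delta(v)$ be $(1,0,2)$, $(0,2,1)$, $(2,1,0)$ for $v$ in $Y_{102}$, $Y_{021}$, $Y_{210}$ respectively, $(0,1,2)$ for $v\in\{(1,1,m-2),(m-2,1,1)\}$,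 $(2,0,1)$ for $v\in\{(1,m-1,0),(m-2,2,0)\}$, and $(1,2,0)$ for all other $v$ with $S(v)=0$. \textbf{Theorem.} For every even $m\ge 6$, the Route E assignment is a valid coloring of $D_3(m)$: for every $v$ the triple $\delta(v)$ is a permutation of $(0,1,2)$, and for every color $c\in\{0,1,2\}$ the map $f_c(v)=v+e_{d_c(v)}$ is a permutation of $V$. Moreover, each of the three color classes (the subdigraph with arcs $v\to f_c(v)$, $v\in V$) is a directed Hamilton cycle of $D_3(m)$, that is, $f_c$ is a single cycle of length $m^3$. -/

import Mathlib

/-- The vertex set `(ℤ/m)³`; a vertex is written `(i, j, k)`. -/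
abbrev Vertex (m : ℕ) : Type := ZMod m × ZMod m × ZMod m

/-- The unit vectors: direction `0`, `1`, `2` is the step `+1` in the coordinate `i`, `j`, `k`. -/
def unitVec (m : ℕ) : Fin 3 → Vertex m :=
  ![(1, 0, 0), (0, 1, 0), (0, 0, 1)]

/-- The directed torus `D₃(m)`: the arcs are `v → v + e` for the three unit vectors `e`. -/
def directedTorus (m : ℕ) : Digraph (Vertex m) where
  Adj v w := ∃ d : Fin 3, w = v + unitVec m d

/-- The layer function `S(i, j, k) = i + j + k`. -/
def layer {m : ℕ} (v : Vertex m) : ZMod m := v.1 + v.2.1 + v.2.2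

/-- An assignment `δ` gives to every vertex `v` and every color `c` a direction `δ v c`. It is a
direction assignment if at every vertex the triple `(δ v 0, δ v 1, δ v 2)` is a permutation of
`(0, 1, 2)`. -/
def IsDirectionAssignment {m : ℕ} (δ : Vertex m → Fin 3 → Fin 3) : Prop :=
  ∀ v, Function.Bijective (δ v)

/-- The color-`c` map `v ↦ v + e_{δ v c}`. -/
def colorMap {m : ℕ} (δ : Vertex m → Fin 3 → Fin 3) (c : Fin 3) (v : Vertex m) : Vertex m :=
  v + unitVec m (δ v c)

/-- A direction assignment is a (valid) coloring of `D₃(m)` if each of the three color maps is a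
permutation of the vertex set. -/
def IsColoring {m : ℕ} (δ : Vertex m → Fin 3 → Fin 3) : Prop :=
  IsDirectionAssignment δ ∧ ∀ c, Function.Bijective (colorMap δ c)

/-- The color class of `c`: the digraph with the arcs `v → colorMap δ c v`. -/
def colorClass {m : ℕ} (δ : Vertex m → Fin 3 → Fin 3) (c : Fin 3) : Digraph (Vertex m) where
  Adj v w := w = colorMap δ c v

/-- `H` is a directed Hamilton cycle of `D₃(m)`: a subdigraph of `D₃(m)` whose arcs are exactly
`v → σ v` for a permutation `σ` of the vertices that is a single cycle of length `m³`. -/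
def IsDirectedHamiltonCycle {m : ℕ} (H : Digraph (Vertex m)) : Prop :=
  H ≤ directedTorus m ∧
    ∃ σ : Equiv.Perm (Vertex m), σ.IsCycle ∧ {v | σ v ≠ v}.ncard = m ^ 3 ∧
      ∀ v w, H.Adj v w ↔ w = σ v

namespace RouteE

/-! The layer-`0` families. All entries are residues modulo `m`, so `m - 1` is written `-1`, etc.
`X` is used for `m ≡ 0, 2 (mod 6)` and `Y` for `m ≡ 4 (mod 6)`. -/

def X102 (m : ℕ) : Finset (Vertex m) :=
  {(0, 0, 0)} ∪ (Finset.Icc 1 (m - 3)).image (fun i : ℕ => ((i : ZMod m), 1, -1 - (i : ZMod m)))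
    ∪ {(-1, 2, -1)}

def X021 (m : ℕ) : Finset (Vertex m) :=
  {(0, 1, -1)} ∪ (Finset.Icc 1 (m - 3)).image (fun i : ℕ => ((i : ZMod m), -(i : ZMod m), 0))
    ∪ {(-1, 0, 1)}

def X210 (m : ℕ) : Finset (Vertex m) :=
  (Finset.Icc 2 (m - 1)).image (fun j : ℕ => (0, (j : ZMod m), -(j : ZMod m))) ∪ {(1, 0, -1)}

def Y102 (m : ℕ) : Finset (Vertex m) :=
  {(0, 0, 0)} ∪ (Finset.Icc 2 (m - 3)).image (fun i : ℕ => ((i : ZMod m), 1, -1 - (i : ZMod m)))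
    ∪ {(-1, 2, -1)}

def Y021 (m : ℕ) : Finset (Vertex m) :=
  {(0, 1, -1)} ∪ (Finset.Icc 2 (m - 3)).image (fun i : ℕ => ((i : ZMod m), -(i : ZMod m), 0))
    ∪ {(-1, 0, 1)}

def Y210 (m : ℕ) : Finset (Vertex m) :=
  (Finset.Icc 2 (m - 1)).image (fun j : ℕ => (0, (j : ZMod m), -(j : ZMod m))) ∪ {(1, 0, -1)}
    ∪ (Finset.Icc 2 (m - 2)).image (fun j : ℕ => (1, (j : ZMod m), -1 - (j : ZMod m)))
    ∪ {(2, 0, -2), (2, -1, -1)}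

/-- The direction triples on layer `0` for `m ≡ 0, 2 (mod 6)`. -/
def layerZeroI (m : ℕ) (v : Vertex m) : Fin 3 → Fin 3 :=
  if v ∈ X102 m then ![1, 0, 2]
  else if v ∈ X021 m then ![0, 2, 1]
  else if v ∈ X210 m then ![2, 1, 0]
  else if v = (-2, 1, 1) then ![0, 1, 2]
  else if v = (-2, 2, 0) then ![2, 0, 1]
  else ![1, 2, 0]

/-- The direction triples on layer `0` for `m ≡ 4 (mod 6)`. -/
def layerZeroII (m : ℕ) (v : Vertex m) : Fin 3 → Fin 3 :=
  if v ∈ Y102 m then ![1, 0, 2]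
  else if v ∈ Y021 m then ![0, 2, 1]
  else if v ∈ Y210 m then ![2, 1, 0]
  else if v = (1, 1, -2) ∨ v = (-2, 1, 1) then ![0, 1, 2]
  else if v = (1, -1, 0) ∨ v = (-2, 2, 0) then ![2, 0, 1]
  else ![1, 2, 0]

end RouteE

/-- The Route E direction assignment (used for even `m ≥ 6`): the triple at `v` is
`(routeE m v 0, routeE m v 1, routeE m v 2)`. -/
def routeE (m : ℕ) (v : Vertex m) : Fin 3 → Fin 3 :=
  if layer v = 0 then
    (if m % 6 = 4 then RouteE.layerZeroII m v else RouteE.layerZeroI m v)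
  else if layer v = 1 then
    (if v.1 = 0 then ![1, 0, 2] else ![2, 0, 1])
  else if layer v = 2 then
    (if v.2.1 = 0 then ![2, 1, 0] else ![0, 1, 2])
  else ![0, 1, 2]

/-! Every step raises the layer by 1, so all orbits of a color map meet layer 0. On a finite set, an
injective map all of whose forward orbits reach one common vertex is a single cycle. Thus two things
are needed per color: injectivity, and a common target. No excursion length is ever counted.

Injectivity is checked layer by layer. Outside layer 0 the direction can be read off the image: a
test on `i` (layer 1) or `j` (layer 2) only switches between directions that preserve the tested
coordinate. On layer 0 it is a finite case check.

For the target, color `c` is viewed in the two coordinates other than `c`. The long run through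
layers 3 to `m - 1` uses direction `c` and is invisible there, so the return map to layer 0 is an
explicit piecewise translation of pairs of residues (`tableZeroI`, ..., `tableTwo`). It is the
diagonal shift (+1, +1) except on a few lines and points. Its orbits are cut again by a coordinate
line: `j = 0` for colors 0 and 2, `k = 0` for color 1. One lap of diagonal steps has no net effect
modulo `m`, so the first return to the line is the sum of the defects met on the way. As `m` is
even, the parity of the coordinate sum decides whether a diagonal run meets the defects on an
antidiagonal.

Apart from boundary points, the resulting maps of the line are: color 0, shift by 2 (first case) or
4 (second case); color 1, shift by 3 (first case), or by 2 on even and 6 on odd points (second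
case); color 2, shift by -1. The boundary values link the residue classes into a chain ending at 0.
For color 1 in the first case this needs `m` not to be 1 modulo 3: otherwise 1, 4, ..., `m - 3`
would close up. Hence the second case, which exchanges the directions of colors 0 and 1 at some
vertices and leaves color 2 alone. -/

/-- `b` is on the forward orbit of `a` under `f`. -/
def Reaches {α : Type*} (f : α → α) (a b : α) : Prop := ∃ n : ℕ, f^[n] a = b

namespace Reaches

variable {α : Type*} {f : α → α} {a b c : α}

theorem refl (f : α → α) (a : α) : Reaches f a a := ⟨0, rfl⟩

theorem of_eq (h : a = b) : Reaches f a b := ⟨0, h⟩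

theorem single (h : f a = b) : Reaches f a b := ⟨1, h⟩

theorem trans : Reaches f a b → Reaches f b c → Reaches f a c := by
  rintro ⟨n, rfl⟩ ⟨k, rfl⟩
  exact ⟨k + n, Function.iterate_add_apply f k n a⟩

theorem head (h : f a = b) (h' : Reaches f b c) : Reaches f a c := (single h).trans h'

theorem tail (h : Reaches f a b) (h' : f b = c) : Reaches f a c := h.trans (single h')

/-- Orbits of a map `T` that is simulated by `f` along `N` give orbits of `f`. -/
theorem of_simulation {β : Type*} {T : β → β} {N : β → α} {s : β → Prop}
    (hs : ∀ x, s x → s (T x)) (h : ∀ x, s x → Reaches f (N x) (N (T x)))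
    {x y : β} (hx : s x) (hxy : Reaches T x y) : Reaches f (N x) (N y) := by
  obtain ⟨n, rfl⟩ := hxy
  induction n generalizing x with
  | zero => exact refl _ _
  | succ n ih => exact (h x hx).trans (ih (hs x hx))

end Reaches

/-! ### Layers and a criterion for a Hamilton cycle. -/

theorem layer_add {m : ℕ} (v w : Vertex m) : layer (v + w) = layer v + layer w := by
  simp only [layer, Prod.fst_add, Prod.snd_add]; ring

theorem layer_unitVec {m : ℕ} (d : Fin 3) : layer (unitVec m d) = 1 := by
  fin_cases d <;> simp [layer, unitVec]

theorem layer_colorMap {m : ℕ} (δ : Vertex m → Fin 3 → Fin 3) (c : Fin 3) (v : Vertex m) :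
    layer (colorMap δ c v) = layer v + 1 := by
  rw [colorMap, layer_add, layer_unitVec]

theorem layer_iterate_colorMap {m : ℕ} (δ : Vertex m → Fin 3 → Fin 3) (c : Fin 3) (v : Vertex m)
    (n : ℕ) : layer ((colorMap δ c)^[n] v) = layer v + n := by
  induction n with
  | zero => simp
  | succ n ih => rw [Function.iterate_succ_apply', layer_colorMap, ih]; push_cast; ring

theorem exists_reaches_layer_zero {m : ℕ} [NeZero m] (δ : Vertex m → Fin 3 → Fin 3) (c : Fin 3)
    (v : Vertex m) : ∃ w, layer w = 0 ∧ Reaches (colorMap δ c) v w :=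
  ⟨_, by rw [layer_iterate_colorMap δ c v (-layer v).val]; simp, _, rfl⟩

theorem unitVec_ne_zero {m : ℕ} (hm : 1 < m) (d : Fin 3) : unitVec m d ≠ 0 := by
  have : Fact (1 < m) := ⟨hm⟩
  fin_cases d <;> simp [unitVec, Prod.ext_iff]

/-- An injective color map all of whose orbits reach a common vertex is a single cycle. -/
theorem isDirectedHamiltonCycle_of_reaches {m : ℕ} (hm : 1 < m) (δ : Vertex m → Fin 3 → Fin 3)
    (c : Fin 3) (hinj : Function.Injective (colorMap δ c)) (x : Vertex m)
    (hx : ∀ v, Reaches (colorMap δ c) v x) :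
    IsDirectedHamiltonCycle (colorClass δ c) := by
  have : NeZero m := ⟨by omega⟩
  have hmove : ∀ v, colorMap δ c v ≠ v := fun v h =>
    unitVec_ne_zero hm (δ v c) (by simpa [colorMap] using h)
  refine ⟨?_, Equiv.ofBijective _ (Finite.injective_iff_bijective.1 hinj), ?_, ?_, ?_⟩
  · intro v w h
    exact ⟨δ v c, h⟩
  -- Forward reachability of `x` from `y` already puts `y` on the cycle of `x`, because the map is a
  -- permutation.
  · refine ⟨x, hmove x, fun y _ => ?_⟩
    obtain ⟨n, hn⟩ := hx y
    refine Equiv.Perm.SameCycle.symm ⟨n, ?_⟩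
    rw [zpow_natCast, Equiv.Perm.coe_pow]
    exact hn
  · have : {v | (Equiv.ofBijective _ (Finite.injective_iff_bijective.1 hinj)) v ≠ v}
        = (Set.univ : Set (Vertex m)) := Set.eq_univ_of_forall hmove
    rw [this, Set.ncard_univ, Nat.card_prod, Nat.card_prod, Nat.card_zmod]
    ring
  · intro v w
    exact Iff.rfl

/-! ### Residue conditions expressed on representatives. -/

namespace RouteE

variable {m : ℕ}

theorem val_eq_iff (hm6 : 6 ≤ m) (x : ZMod m) (n : ℕ) (hn : n < m) :
    x = n ↔ x.val = n := by
  have : NeZero m := ⟨by omega⟩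
  constructor
  · rintro rfl; exact ZMod.val_cast_of_lt hn
  · rintro rfl; simp

theorem eq_zero_iff_val (hm6 : 6 ≤ m) (x : ZMod m) : x = 0 ↔ x.val = 0 := by
  rw [ZMod.val_eq_zero]

theorem eq_one_iff_val (hm6 : 6 ≤ m) (x : ZMod m) : x = 1 ↔ x.val = 1 := by
  simpa using val_eq_iff hm6 x 1 (by omega)

theorem eq_two_iff_val (hm6 : 6 ≤ m) (x : ZMod m) : x = 2 ↔ x.val = 2 := by
  simpa using val_eq_iff hm6 x 2 (by omega)

theorem eq_neg_natCast_iff_val (hm6 : 6 ≤ m) (x : ZMod m) (n : ℕ) (h0 : 0 < n) (hn : n < m) :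
    x = -n ↔ x.val = m - n := by
  rw [← val_eq_iff hm6 x (m - n) (by omega), Nat.cast_sub hn.le]
  simp

theorem eq_neg_one_iff_val (hm6 : 6 ≤ m) (x : ZMod m) : x = -1 ↔ x.val = m - 1 := by
  simpa using eq_neg_natCast_iff_val hm6 x 1 (by omega) (by omega)

theorem eq_neg_two_iff_val (hm6 : 6 ≤ m) (x : ZMod m) : x = -2 ↔ x.val = m - 2 := by
  simpa using eq_neg_natCast_iff_val hm6 x 2 (by omega) (by omega)

theorem eq_neg_iff_val (hm6 : 6 ≤ m) (x y : ZMod m) :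
    x = -y ↔ x.val + y.val = 0 ∨ x.val + y.val = m := by
  have : NeZero m := ⟨by omega⟩
  have hx := ZMod.val_lt x
  have hy := ZMod.val_lt y
  have h : x = -y ↔ ((x.val + y.val : ℕ) : ZMod m) = 0 := by
    rw [eq_neg_iff_add_eq_zero]; simp
  rw [h, ZMod.natCast_eq_zero_iff]
  constructor
  · rintro ⟨q, hq⟩
    have : q < 2 := by
      by_contra hq2
      have : m * 2 ≤ m * q := Nat.mul_le_mul_left m (by omega)
      omega
    interval_cases q <;> omega
  · rintro (h | h) <;> simp [h]

theorem eq_neg_one_sub_iff_val (hm6 : 6 ≤ m) (x y : ZMod m) :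
    x = -1 - y ↔ x.val + y.val + 1 = m ∨ x.val + y.val + 1 = 2 * m := by
  have : NeZero m := ⟨by omega⟩
  have hx := ZMod.val_lt x
  have hy := ZMod.val_lt y
  have h : x = -1 - y ↔ ((x.val + y.val + 1 : ℕ) : ZMod m) = 0 := by
    rw [← sub_eq_zero]; simp; constructor <;> intro h <;> rw [← h] <;> ring
  rw [h, ZMod.natCast_eq_zero_iff]
  constructor
  · rintro ⟨q, hq⟩
    have : q < 3 := by
      by_contra hq2
      have : m * 3 ≤ m * q := Nat.mul_le_mul_left m (by omega)
      omega
    interval_cases q <;> omega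
  · rintro (h | h) <;> simp [h]

theorem layer_eq_zero_iff_val (hm6 : 6 ≤ m) (v : Vertex m) :
    layer v = 0 ↔ v.1.val + v.2.1.val + v.2.2.val = 0 ∨ v.1.val + v.2.1.val + v.2.2.val = m ∨
      v.1.val + v.2.1.val + v.2.2.val = 2 * m := by
  have : NeZero m := ⟨by omega⟩
  have hx := ZMod.val_lt v.1
  have hy := ZMod.val_lt v.2.1
  have hz := ZMod.val_lt v.2.2
  have h : layer v = 0 ↔ ((v.1.val + v.2.1.val + v.2.2.val : ℕ) : ZMod m) = 0 := by
    simp [layer]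
  rw [h, ZMod.natCast_eq_zero_iff]
  constructor
  · rintro ⟨q, hq⟩
    have : q < 3 := by
      by_contra hq2
      have : m * 3 ≤ m * q := Nat.mul_le_mul_left m (by omega)
      omega
    interval_cases q <;> omega
  · rintro (h | h | h) <;> simp [h]

/-- The coordinate `p` of `v` recovers the index of the family, so the existential collapses to one
candidate. -/
theorem mem_image_triple {s : Finset ℕ} {g : ℕ → Vertex m} (v : Vertex m) (p : ZMod m)
    (hs : ∀ n ∈ s, n < m) (hg : ∀ n ∈ s, g n = v → p = n) (hm6 : 6 ≤ m) :
    v ∈ s.image g ↔ p.val ∈ s ∧ g p.val = v := by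
  rw [Finset.mem_image]
  constructor
  · rintro ⟨n, hn, h⟩
    have := (val_eq_iff hm6 p n (hs n hn)).1 (hg n hn h)
    rw [this]
    exact ⟨hn, h⟩
  · rintro ⟨hp, h⟩
    exact ⟨_, hp, h⟩

end RouteE

/-! ### Layer-0 directions as functions of two residues. -/

namespace RouteE

variable {m : ℕ}

theorem val_lt_of_six_le (hm6 : 6 ≤ m) (x : ZMod m) : x.val < m := by
  have : NeZero m := ⟨by omega⟩
  exact ZMod.val_lt x

/-- On layer 0 two coordinates determine the third. This and the analogous descriptions below turn
the families into linear conditions on natural numbers, suited to `omega` and `grind`. -/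
theorem mem_X102 (hm6 : 6 ≤ m) (v : Vertex m) (hv : layer v = 0) : v ∈ X102 m ↔
    (v.1.val = 0 ∧ v.2.1.val = 0) ∨ (1 ≤ v.1.val ∧ v.1.val ≤ m - 3 ∧ v.2.1.val = 1) ∨
      (v.1.val = m - 1 ∧ v.2.1.val = 2) := by
  have : NeZero m := ⟨by omega⟩
  rw [layer_eq_zero_iff_val hm6] at hv
  have h0 := val_lt_of_six_le hm6 v.1
  have h1 := val_lt_of_six_le hm6 v.2.1
  have h2 := val_lt_of_six_le hm6 v.2.2
  rw [X102, Finset.mem_union, Finset.mem_union, mem_image_triple v v.1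
    (by simp only [Finset.mem_Icc]; omega) (by rintro n - rfl; rfl) hm6]
  simp only [Finset.mem_singleton, Prod.ext_iff, Finset.mem_Icc, ZMod.natCast_zmod_val, true_and,
    eq_zero_iff_val hm6, eq_one_iff_val hm6, eq_two_iff_val hm6, eq_neg_one_iff_val hm6,
    eq_comm (b := v.2.2), eq_comm (b := v.2.1), eq_neg_one_sub_iff_val hm6]
  omega

theorem mem_Y102 (hm6 : 6 ≤ m) (v : Vertex m) (hv : layer v = 0) : v ∈ Y102 m ↔
    (v.1.val = 0 ∧ v.2.1.val = 0) ∨ (2 ≤ v.1.val ∧ v.1.val ≤ m - 3 ∧ v.2.1.val = 1) ∨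
      (v.1.val = m - 1 ∧ v.2.1.val = 2) := by
  have : NeZero m := ⟨by omega⟩
  rw [layer_eq_zero_iff_val hm6] at hv
  have h0 := val_lt_of_six_le hm6 v.1
  have h1 := val_lt_of_six_le hm6 v.2.1
  have h2 := val_lt_of_six_le hm6 v.2.2
  rw [Y102, Finset.mem_union, Finset.mem_union, mem_image_triple v v.1
    (by simp only [Finset.mem_Icc]; omega) (by rintro n - rfl; rfl) hm6]
  simp only [Finset.mem_singleton, Prod.ext_iff, Finset.mem_Icc, ZMod.natCast_zmod_val, true_and,
    eq_zero_iff_val hm6, eq_one_iff_val hm6, eq_two_iff_val hm6, eq_neg_one_iff_val hm6,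
    eq_comm (b := v.2.2), eq_comm (b := v.2.1), eq_neg_one_sub_iff_val hm6]
  omega

theorem mem_X021 (hm6 : 6 ≤ m) (v : Vertex m) (hv : layer v = 0) : v ∈ X021 m ↔
    (v.1.val = 0 ∧ v.2.1.val = 1) ∨ (1 ≤ v.1.val ∧ v.1.val ≤ m - 3 ∧ v.2.2.val = 0) ∨
      (v.1.val = m - 1 ∧ v.2.1.val = 0) := by
  have : NeZero m := ⟨by omega⟩
  rw [layer_eq_zero_iff_val hm6] at hv
  have h0 := val_lt_of_six_le hm6 v.1
  have h1 := val_lt_of_six_le hm6 v.2.1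
  have h2 := val_lt_of_six_le hm6 v.2.2
  rw [X021, Finset.mem_union, Finset.mem_union, mem_image_triple v v.1
    (by simp only [Finset.mem_Icc]; omega) (by rintro n - rfl; rfl) hm6]
  simp only [Finset.mem_singleton, Prod.ext_iff, Finset.mem_Icc, ZMod.natCast_zmod_val, true_and,
    eq_comm (b := v.2.2), eq_comm (b := v.2.1),
    eq_zero_iff_val hm6, eq_one_iff_val hm6, eq_neg_one_iff_val hm6,
    eq_neg_iff_val hm6]
  omega

theorem mem_Y021 (hm6 : 6 ≤ m) (v : Vertex m) (hv : layer v = 0) : v ∈ Y021 m ↔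
    (v.1.val = 0 ∧ v.2.1.val = 1) ∨ (2 ≤ v.1.val ∧ v.1.val ≤ m - 3 ∧ v.2.2.val = 0) ∨
      (v.1.val = m - 1 ∧ v.2.1.val = 0) := by
  have : NeZero m := ⟨by omega⟩
  rw [layer_eq_zero_iff_val hm6] at hv
  have h0 := val_lt_of_six_le hm6 v.1
  have h1 := val_lt_of_six_le hm6 v.2.1
  have h2 := val_lt_of_six_le hm6 v.2.2
  rw [Y021, Finset.mem_union, Finset.mem_union, mem_image_triple v v.1
    (by simp only [Finset.mem_Icc]; omega) (by rintro n - rfl; rfl) hm6]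
  simp only [Finset.mem_singleton, Prod.ext_iff, Finset.mem_Icc, ZMod.natCast_zmod_val, true_and,
    eq_comm (b := v.2.2), eq_comm (b := v.2.1),
    eq_zero_iff_val hm6, eq_one_iff_val hm6, eq_neg_one_iff_val hm6,
    eq_neg_iff_val hm6]
  omega

theorem mem_X210 (hm6 : 6 ≤ m) (v : Vertex m) (hv : layer v = 0) : v ∈ X210 m ↔
    (v.1.val = 0 ∧ 2 ≤ v.2.1.val) ∨ (v.1.val = 1 ∧ v.2.1.val = 0) := by
  have : NeZero m := ⟨by omega⟩
  rw [layer_eq_zero_iff_val hm6] at hv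
  have h0 := val_lt_of_six_le hm6 v.1
  have h1 := val_lt_of_six_le hm6 v.2.1
  have h2 := val_lt_of_six_le hm6 v.2.2
  rw [X210, Finset.mem_union, mem_image_triple v v.2.1
    (by simp only [Finset.mem_Icc]; omega) (by rintro n - rfl; rfl) hm6]
  simp only [Finset.mem_singleton, Prod.ext_iff, Finset.mem_Icc, ZMod.natCast_zmod_val, true_and,
    eq_comm (b := v.2.2), eq_comm (b := v.1),
    eq_zero_iff_val hm6, eq_one_iff_val hm6, eq_neg_one_iff_val hm6,
    eq_neg_iff_val hm6]
  omega

theorem mem_Y210 (hm6 : 6 ≤ m) (v : Vertex m) (hv : layer v = 0) : v ∈ Y210 m ↔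
    (v.1.val = 0 ∧ 2 ≤ v.2.1.val) ∨ (v.1.val = 1 ∧ v.2.1.val ≠ 1 ∧ v.2.1.val ≠ m - 1) ∨
      (v.1.val = 2 ∧ (v.2.1.val = 0 ∨ v.2.1.val = m - 1)) := by
  have : NeZero m := ⟨by omega⟩
  rw [layer_eq_zero_iff_val hm6] at hv
  have h0 := val_lt_of_six_le hm6 v.1
  have h1 := val_lt_of_six_le hm6 v.2.1
  have h2 := val_lt_of_six_le hm6 v.2.2
  rw [Y210, Finset.mem_union, Finset.mem_union, Finset.mem_union, mem_image_triple v v.2.1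
    (by simp only [Finset.mem_Icc]; omega) (by rintro n - rfl; rfl) hm6, mem_image_triple v v.2.1
    (by simp only [Finset.mem_Icc]; omega) (by rintro n - rfl; rfl) hm6]
  simp only [Finset.mem_singleton, Finset.mem_insert, Prod.ext_iff, Finset.mem_Icc,
    ZMod.natCast_zmod_val, true_and, eq_comm (b := v.2.2), eq_comm (b := v.1),
    eq_zero_iff_val hm6, eq_one_iff_val hm6, eq_two_iff_val hm6, eq_neg_one_iff_val hm6,
    eq_neg_two_iff_val hm6, eq_neg_iff_val hm6, eq_neg_one_sub_iff_val hm6]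
  omega

/-- Direction of color `0` at the layer-`0` vertex `(-(j+k), j, k)`, first case. -/
def dirZeroI (m j k : ℕ) : Fin 3 :=
  if (j = 1 ∧ k = m - 1) ∨ (3 ≤ j ∧ k = 0) ∨ (j = 0 ∧ k = 1) ∨ (j = 1 ∧ k = 1) then 0
  else if (2 ≤ j ∧ j + k = m) ∨ (j = 0 ∧ k = m - 1) ∨ (j = 2 ∧ k = 0) then 2
  else 1

/-- Direction of color `0` at the layer-`0` vertex `(-(j+k), j, k)`, second case. -/
def dirZeroII (m j k : ℕ) : Fin 3 :=
  if (j = 1 ∧ (k = m - 1 ∨ k = m - 2)) ∨ (3 ≤ j ∧ j ≤ m - 2 ∧ k = 0) ∨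
    (j = 0 ∧ k = 1) ∨ (j = 1 ∧ k = 1) then 0
  else if (2 ≤ j ∧ (j + k = m ∨ j + k = m - 1)) ∨ (j = 0 ∧ (k = m - 1 ∨ k = m - 2)) ∨
    (j = m - 1 ∧ k = m - 1) ∨ (j = 2 ∧ k = 0) then 2
  else 1

/-- Direction of color `1` at the layer-`0` vertex `(i, -(i+k), k)`, first case. -/
def dirOneI (m i k : ℕ) : Fin 3 :=
  if (i = 0 ∧ k = 0) ∨ (1 ≤ i ∧ i ≤ m - 3 ∧ i + k = m - 1) ∨ (i = m - 1 ∧ k = m - 1) ∨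
    (i = m - 2 ∧ k = 0) then 0
  else if (i = 0 ∧ 1 ≤ k ∧ k ≤ m - 2) ∨ (i = 1 ∧ k = m - 1) ∨ (i = m - 2 ∧ k = 1) then 1
  else 2

/-- Direction of color `1` at the layer-`0` vertex `(i, -(i+k), k)`, second case. -/
def dirOneII (m i k : ℕ) : Fin 3 :=
  if (i = 0 ∧ k = 0) ∨ (2 ≤ i ∧ i ≤ m - 3 ∧ i + k = m - 1) ∨ (i = m - 1 ∧ k = m - 1) ∨
    (i = 1 ∧ k = 0) ∨ (i = m - 2 ∧ k = 0) then 0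
  else if (i = 0 ∧ 1 ≤ k ∧ k ≤ m - 2) ∨ (i = 1 ∧ 1 ≤ k) ∨ (i = 2 ∧ m - 2 ≤ k) ∨
    (i = m - 2 ∧ k = 1) then 1
  else 2

/-- Direction of color `2` at the layer-`0` vertex `(i, j, -(i+j))`. -/
def dirTwo (m i j : ℕ) : Fin 3 :=
  if (i = 0 ∧ j = 0) ∨ (1 ≤ i ∧ i ≤ m - 2 ∧ j = 1) ∨ (i = m - 1 ∧ j = 2) then 2
  else if (i = 0 ∧ j = 1) ∨ (1 ≤ i ∧ i ≤ m - 2 ∧ i + j = m) ∨ (i = m - 1 ∧ j = 0) then 1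
  else 0

theorem routeE_layer_zero_of_ne (hm6 : 6 ≤ m) (h4 : m % 6 ≠ 4) (v : Vertex m)
    (hv : layer v = 0) : routeE m v 0 = dirZeroI m v.2.1.val v.2.2.val ∧
      routeE m v 1 = dirOneI m v.1.val v.2.2.val ∧
      routeE m v 2 = dirTwo m v.1.val v.2.1.val := by
  rw [routeE, if_pos hv, if_neg h4, layerZeroI]
  simp only [mem_X102 hm6 v hv, mem_X021 hm6 v hv, mem_X210 hm6 v hv, Prod.ext_iff,
    eq_neg_two_iff_val hm6, eq_one_iff_val hm6, eq_two_iff_val hm6,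
    eq_zero_iff_val hm6]
  rw [layer_eq_zero_iff_val hm6] at hv
  have h0 := val_lt_of_six_le hm6 v.1
  have h1 := val_lt_of_six_le hm6 v.2.1
  have h2 := val_lt_of_six_le hm6 v.2.2
  generalize v.1.val = a at *
  generalize v.2.1.val = b at *
  generalize v.2.2.val = c at *
  clear h4 v
  refine ⟨?_, ?_, ?_⟩ <;> split_ifs <;>
    simp only [Matrix.cons_val, dirZeroI, dirOneI, dirTwo] <;> grind (splits := 30)

theorem routeE_layer_zero_of_eq (hm6 : 6 ≤ m) (h4 : m % 6 = 4) (v : Vertex m)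
    (hv : layer v = 0) : routeE m v 0 = dirZeroII m v.2.1.val v.2.2.val ∧
      routeE m v 1 = dirOneII m v.1.val v.2.2.val ∧
      routeE m v 2 = dirTwo m v.1.val v.2.1.val := by
  rw [routeE, if_pos hv, if_pos h4, layerZeroII]
  simp only [mem_Y102 hm6 v hv, mem_Y021 hm6 v hv, mem_Y210 hm6 v hv, Prod.ext_iff,
    eq_neg_two_iff_val hm6, eq_neg_one_iff_val hm6, eq_one_iff_val hm6, eq_two_iff_val hm6,
    eq_zero_iff_val hm6]
  rw [layer_eq_zero_iff_val hm6] at hv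
  have h0 := val_lt_of_six_le hm6 v.1
  have h1 := val_lt_of_six_le hm6 v.2.1
  have h2 := val_lt_of_six_le hm6 v.2.2
  generalize v.1.val = a at *
  generalize v.2.1.val = b at *
  generalize v.2.2.val = c at *
  -- The case check uses the congruence only through this bound.
  have h10 : 10 ≤ m := by omega
  clear h4 v
  refine ⟨?_, ?_, ?_⟩ <;> split_ifs <;>
    simp only [Matrix.cons_val, dirZeroII, dirOneII, dirTwo] <;> grind (splits := 30)

end RouteE

/-! ### From layer 0 back to layer 0. -/

namespace RouteE

variable {m : ℕ}

theorem natCast_ne (hm6 : 6 ≤ m) {a b : ℕ} (ha : a < 6) (hb : b < 6) (hab : a ≠ b) :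
    (a : ZMod m) ≠ b := by
  intro h
  have := (val_eq_iff hm6 (a : ZMod m) b (by omega)).1 h
  rw [ZMod.val_cast_of_lt (by omega)] at this
  exact hab this

theorem routeE_layer_one (hm6 : 6 ≤ m) (v : Vertex m) (hv : layer v = 1) (c : Fin 3) :
    routeE m v c = if v.1 = 0 then ![1, 0, 2] c else ![2, 0, 1] c := by
  have h10 : (1 : ZMod m) ≠ 0 := by
    simpa using natCast_ne hm6 (a := 1) (b := 0) (by omega) (by omega) (by omega)
  rw [routeE, hv, if_neg h10, if_pos rfl, ite_apply]

theorem routeE_layer_two (hm6 : 6 ≤ m) (v : Vertex m) (hv : layer v = 2) (c : Fin 3) :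
    routeE m v c = if v.2.1 = 0 then ![2, 1, 0] c else ![0, 1, 2] c := by
  have h20 : (2 : ZMod m) ≠ 0 := by
    simpa using natCast_ne hm6 (a := 2) (b := 0) (by omega) (by omega) (by omega)
  have h21 : (2 : ZMod m) ≠ 1 := by
    simpa using natCast_ne hm6 (a := 2) (b := 1) (by omega) (by omega) (by omega)
  rw [routeE, hv, if_neg h20, if_neg h21, if_pos rfl, ite_apply]

theorem colorMap_of_layer (v : Vertex m) (h0 : layer v ≠ 0) (h1 : layer v ≠ 1)
    (h2 : layer v ≠ 2) (c : Fin 3) : colorMap (routeE m) c v = v + unitVec m c := by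
  rw [colorMap, routeE, if_neg h0, if_neg h1, if_neg h2]
  fin_cases c <;> rfl

theorem iterate_colorMap_of_layer_three (hm6 : 6 ≤ m) (c : Fin 3) (v : Vertex m)
    (hv : layer v = 3) (n : ℕ) (hn : n + 3 ≤ m) :
    (colorMap (routeE m) c)^[n] v = v + n • unitVec m c := by
  induction n with
  | zero => simp
  | succ n ih =>
    have hl : layer ((colorMap (routeE m) c)^[n] v) = ((n + 3 : ℕ) : ZMod m) := by
      rw [layer_iterate_colorMap, hv]; push_cast; ring
    have hne : ∀ a : ℕ, a < 3 → layer ((colorMap (routeE m) c)^[n] v) ≠ (a : ZMod m) := by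
      intro a ha h
      rw [hl, val_eq_iff hm6 _ a (by omega), ZMod.val_cast_of_lt (by omega)] at h
      omega
    rw [Function.iterate_succ_apply', colorMap_of_layer _ (by simpa using hne 0 (by omega))
      (by simpa using hne 1 (by omega)) (by simpa using hne 2 (by omega)), ih (by omega),
      succ_nsmul, add_assoc]

/-- Layers 3 to `m - 1` all use direction `c`, and `m - 3` such steps equal -3 of them because `m`
times a unit vector vanishes. -/
theorem reaches_of_layer_three (hm6 : 6 ≤ m) (c : Fin 3) (v : Vertex m) (hv : layer v = 3) :
    Reaches (colorMap (routeE m) c) v (v - 3 • unitVec m c) := by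
  refine ⟨m - 3, ?_⟩
  rw [iterate_colorMap_of_layer_three hm6 c v hv (m - 3) (by omega), sub_eq_add_neg]
  congr 1
  rw [eq_neg_iff_add_eq_zero, ← add_nsmul, Nat.sub_add_cancel (by omega)]
  fin_cases c <;> simp [unitVec]

/-- The vertex of layer `s` with coordinates `j = x` and `k = y`. -/
def nodeZero (m : ℕ) (s : ZMod m) (x y : ℕ) : Vertex m := (s - x - y, x, y)

/-- The vertex of layer `s` with coordinates `i = x` and `k = y`. -/
def nodeOne (m : ℕ) (s : ZMod m) (x y : ℕ) : Vertex m := (x, s - x - y, y)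

/-- The vertex of layer `s` with coordinates `i = x` and `j = y`. -/
def nodeTwo (m : ℕ) (s : ZMod m) (x y : ℕ) : Vertex m := (x, y, s - x - y)

theorem layer_nodeZero (s : ZMod m) (x y : ℕ) : layer (nodeZero m s x y) = s := by
  simp only [layer, nodeZero]; ring

theorem layer_nodeOne (s : ZMod m) (x y : ℕ) : layer (nodeOne m s x y) = s := by
  simp only [layer, nodeOne]; ring

theorem layer_nodeTwo (s : ZMod m) (x y : ℕ) : layer (nodeTwo m s x y) = s := by
  simp [layer, nodeTwo]

/-- Successor modulo `m` on representatives. -/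
def inc (m x : ℕ) : ℕ := if x + 1 = m then 0 else x + 1

theorem inc_lt {x : ℕ} (hx : x < m) : inc m x < m := by
  unfold inc; split_ifs <;> omega

theorem natCast_inc (x : ℕ) : ((inc m x : ℕ) : ZMod m) = x + 1 := by
  unfold inc
  split_ifs with h
  · have : ((x + 1 : ℕ) : ZMod m) = 0 := by rw [h]; simp
    push_cast at this
    rw [this]; simp
  · push_cast; rfl

theorem natCast_eq_zero_iff_of_lt {x : ℕ} (hx : x < m) : (x : ZMod m) = 0 ↔ x = 0 := by
  rw [ZMod.natCast_eq_zero_iff]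
  exact ⟨fun h => Nat.eq_zero_of_dvd_of_lt h hx, fun h => h ▸ dvd_zero m⟩

/-- The layer-1 test `i = 0`, read in the coordinates `(j, k)`, where `i = 1 - j - k`. -/
theorem one_sub_natCast_eq_zero_iff {x y : ℕ} (hm : 1 < m) (hx : x < m) (hy : y < m) :
    (1 - x - y : ZMod m) = 0 ↔ x + y = 1 ∨ x + y = m + 1 := by
  have h : (1 - x - y : ZMod m) = 0 ↔ (((x + y : ℕ) : ℤ) : ZMod m) = ((1 : ℤ) : ZMod m) := by
    push_cast
    rw [sub_sub, sub_eq_zero, eq_comm]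
  rw [h, ZMod.intCast_eq_intCast_iff_dvd_sub]
  constructor
  · rintro ⟨q, hq⟩
    have h1 : -2 < q := by
      by_contra hq2
      have : (m : ℤ) * q ≤ m * (-2) := mul_le_mul_of_nonneg_left (by omega) (by omega)
      omega
    have h2 : q < 1 := by
      by_contra hq2
      have : (m : ℤ) * 1 ≤ m * q := mul_le_mul_of_nonneg_left (by omega) (by omega)
      omega
    interval_cases q <;> omega
  · rintro (h | h)
    · exact ⟨0, by rw [h]; simp⟩
    · exact ⟨-1, by rw [h]; push_cast; ring⟩

/-- Color `0` from layer `1` back to layer `0`. -/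
def returnZero (m q r : ℕ) : ℕ × ℕ :=
  if q + r = 1 ∨ q + r = m + 1 then (if inc m q = 0 then (0, inc m r) else (inc m q, r))
  else if q = 0 then (0, inc m (inc m r)) else (q, inc m r)

/-- Color `2` from layer `1` back to layer `0`. -/
def returnTwo (m q r : ℕ) : ℕ × ℕ :=
  if q = 0 then (if r = 0 then (inc m q, r) else (q, r))
  else if inc m r = 0 then (inc m q, 0) else (q, inc m r)

/-- Only the steps in layers 1 and 2 are visible in `(j, k)`: the run from layer 3 onwards changes
`i` alone. -/
theorem reaches_returnZero (hm6 : 6 ≤ m) {q r : ℕ} (hq : q < m) (hr : r < m) :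
    Reaches (colorMap (routeE m) 0) (nodeZero m 1 q r)
      (nodeZero m 0 (returnZero m q r).1 (returnZero m q r).2) := by
  set f := colorMap (routeE m) 0 with hf
  have hl := layer_nodeZero (1 : ZMod m) q r
  have h3 : layer (f (f (nodeZero m 1 q r))) = 3 := by
    rw [hf, layer_colorMap, layer_colorMap, hl]; norm_num
  refine Reaches.head rfl (Reaches.head rfl ((reaches_of_layer_three hm6 0 _ h3).trans
    (Reaches.of_eq ?_)))
  have h1 : f (nodeZero m 1 q r) =
      if q + r = 1 ∨ q + r = m + 1 then nodeZero m 2 (inc m q) r else nodeZero m 2 q (inc m r) := by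
    rw [hf, colorMap, routeE_layer_one hm6 _ hl]
    have := one_sub_natCast_eq_zero_iff (by omega) hq hr
    simp only [nodeZero, this]
    split_ifs <;> simp [unitVec, natCast_inc] <;> ring
  have h2 : ∀ x y : ℕ, x < m → f (nodeZero m 2 x y) =
      if x = 0 then nodeZero m 3 x (inc m y) else nodeZero m 3 x y := by
    intro x y hx
    rw [hf, colorMap, routeE_layer_two hm6 _ (layer_nodeZero _ _ _)]
    simp only [nodeZero, natCast_eq_zero_iff_of_lt hx]
    split_ifs <;> simp [unitVec, natCast_inc] <;> ring
  rw [h1, returnZero]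
  split_ifs with a b c
  · rw [h2 _ _ (inc_lt hq), if_pos b, b]
    simp [nodeZero, unitVec]
  · rw [h2 _ _ (inc_lt hq), if_neg b]
    simp [nodeZero, unitVec]; ring
  · subst c
    rw [h2 _ _ hq, if_pos rfl]
    simp [nodeZero, unitVec]
  · rw [h2 _ _ hq, if_neg c]
    simp [nodeZero, unitVec]; ring

theorem reaches_returnTwo (hm6 : 6 ≤ m) {q r : ℕ} (hq : q < m) (hr : r < m) :
    Reaches (colorMap (routeE m) 2) (nodeTwo m 1 q r)
      (nodeTwo m 0 (returnTwo m q r).1 (returnTwo m q r).2) := by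
  set f := colorMap (routeE m) 2 with hf
  have hl := layer_nodeTwo (1 : ZMod m) q r
  have h3 : layer (f (f (nodeTwo m 1 q r))) = 3 := by
    rw [hf, layer_colorMap, layer_colorMap, hl]; norm_num
  refine Reaches.head rfl (Reaches.head rfl ((reaches_of_layer_three hm6 2 _ h3).trans
    (Reaches.of_eq ?_)))
  have h1 : f (nodeTwo m 1 q r) =
      if q = 0 then nodeTwo m 2 q r else nodeTwo m 2 q (inc m r) := by
    rw [hf, colorMap, routeE_layer_one hm6 _ hl]
    simp only [nodeTwo, natCast_eq_zero_iff_of_lt hq]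
    split_ifs <;> simp [unitVec, natCast_inc] <;> ring
  have h2 : ∀ x y : ℕ, y < m → f (nodeTwo m 2 x y) =
      if y = 0 then nodeTwo m 3 (inc m x) y else nodeTwo m 3 x y := by
    intro x y hy
    rw [hf, colorMap, routeE_layer_two hm6 _ (layer_nodeTwo _ _ _)]
    simp only [nodeTwo, natCast_eq_zero_iff_of_lt hy]
    split_ifs <;> simp [unitVec, natCast_inc] <;> ring
  rw [h1, returnTwo]
  split_ifs with a b c
  · rw [h2 _ _ hr, if_pos b]
    simp [nodeTwo, unitVec]; ring
  · rw [h2 _ _ hr, if_neg b]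
    simp [nodeTwo, unitVec]; ring
  · rw [h2 _ _ (inc_lt hr), if_pos c, c]
    simp [nodeTwo, unitVec]
  · rw [h2 _ _ (inc_lt hr), if_neg c]
    simp [nodeTwo, unitVec]; ring

/-- Color 1 moves in direction 0 in both branches of layer 1 and in direction 1 in both branches of
layer 2, so no case distinction survives. -/
theorem reaches_returnOne (hm6 : 6 ≤ m) (q r : ℕ) :
    Reaches (colorMap (routeE m) 1) (nodeOne m 1 q r) (nodeOne m 0 (inc m q) r) := by
  set f := colorMap (routeE m) 1 with hf
  have hl := layer_nodeOne (1 : ZMod m) q r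
  have h3 : layer (f (f (nodeOne m 1 q r))) = 3 := by
    rw [hf, layer_colorMap, layer_colorMap, hl]; norm_num
  refine Reaches.head rfl (Reaches.head rfl ((reaches_of_layer_three hm6 1 _ h3).trans
    (Reaches.of_eq ?_)))
  have h1 : f (nodeOne m 1 q r) = nodeOne m 2 (inc m q) r := by
    have hd : routeE m (nodeOne m 1 q r) 1 = 0 := by
      rw [routeE_layer_one hm6 _ hl]; split_ifs <;> rfl
    rw [hf, colorMap, hd]
    simp [nodeOne, unitVec, natCast_inc]; ring
  have h2 : ∀ x y : ℕ, f (nodeOne m 2 x y) = nodeOne m 3 x y := by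
    intro x y
    have hd : routeE m (nodeOne m 2 x y) 1 = 1 := by
      rw [routeE_layer_two hm6 _ (layer_nodeOne _ _ _)]; split_ifs <;> rfl
    rw [hf, colorMap, hd]
    simp [nodeOne, unitVec]; ring
  rw [h1, h2]
  simp [nodeOne, unitVec]; ring

/-- The first layer step of color `0` in the coordinates `(j, k)`. -/
def stepZero (m : ℕ) (d : Fin 3) (j k : ℕ) : ℕ × ℕ := ![(j, k), (inc m j, k), (j, inc m k)] d

/-- The first layer step of color `1` in the coordinates `(i, k)`. -/
def stepOne (m : ℕ) (d : Fin 3) (i k : ℕ) : ℕ × ℕ := ![(inc m i, k), (i, k), (i, inc m k)] d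

/-- The first layer step of color `2` in the coordinates `(i, j)`. -/
def stepTwo (m : ℕ) (d : Fin 3) (i j : ℕ) : ℕ × ℕ := ![(inc m i, j), (i, inc m j), (i, j)] d

theorem colorMap_nodeZero (d : Fin 3) (x y : ℕ) (h : routeE m (nodeZero m 0 x y) 0 = d) :
    colorMap (routeE m) 0 (nodeZero m 0 x y) =
      nodeZero m 1 (stepZero m d x y).1 (stepZero m d x y).2 := by
  rw [colorMap, h]
  fin_cases d <;> simp [nodeZero, stepZero, unitVec, natCast_inc] <;> ring

theorem colorMap_nodeOne (d : Fin 3) (x y : ℕ) (h : routeE m (nodeOne m 0 x y) 1 = d) :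
    colorMap (routeE m) 1 (nodeOne m 0 x y) =
      nodeOne m 1 (stepOne m d x y).1 (stepOne m d x y).2 := by
  rw [colorMap, h]
  fin_cases d <;> simp [nodeOne, stepOne, unitVec, natCast_inc] <;> ring

theorem colorMap_nodeTwo (d : Fin 3) (x y : ℕ) (h : routeE m (nodeTwo m 0 x y) 2 = d) :
    colorMap (routeE m) 2 (nodeTwo m 0 x y) =
      nodeTwo m 1 (stepTwo m d x y).1 (stepTwo m d x y).2 := by
  rw [colorMap, h]
  fin_cases d <;> simp [nodeTwo, stepTwo, unitVec, natCast_inc] <;> ring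

theorem exists_nodeZero (hm6 : 6 ≤ m) (v : Vertex m) (hv : layer v = 0) :
    v = nodeZero m 0 v.2.1.val v.2.2.val := by
  have : NeZero m := ⟨by omega⟩
  simp only [nodeZero, ZMod.natCast_zmod_val, Prod.ext_iff, and_true]
  rw [← hv, layer]; ring

theorem exists_nodeOne (hm6 : 6 ≤ m) (v : Vertex m) (hv : layer v = 0) :
    v = nodeOne m 0 v.1.val v.2.2.val := by
  have : NeZero m := ⟨by omega⟩
  simp only [nodeOne, ZMod.natCast_zmod_val, Prod.ext_iff, and_true, true_and]
  rw [← hv, layer]; ring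

theorem exists_nodeTwo (hm6 : 6 ≤ m) (v : Vertex m) (hv : layer v = 0) :
    v = nodeTwo m 0 v.1.val v.2.1.val := by
  have : NeZero m := ⟨by omega⟩
  simp only [nodeTwo, ZMod.natCast_zmod_val, Prod.ext_iff, true_and]
  rw [← hv, layer]; ring

theorem stepZero_lt (d : Fin 3) {x y : ℕ} (hx : x < m) (hy : y < m) :
    (stepZero m d x y).1 < m ∧ (stepZero m d x y).2 < m := by
  fin_cases d <;> simp [stepZero, inc_lt, *]

theorem stepTwo_lt (d : Fin 3) {x y : ℕ} (hx : x < m) (hy : y < m) :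
    (stepTwo m d x y).1 < m ∧ (stepTwo m d x y).2 < m := by
  fin_cases d <;> simp [stepTwo, inc_lt, *]

theorem reaches_nodeZero (hm6 : 6 ≤ m) (d : Fin 3) {x y : ℕ} (hx : x < m) (hy : y < m)
    (h : routeE m (nodeZero m 0 x y) 0 = d) {p : ℕ × ℕ}
    (hp : returnZero m (stepZero m d x y).1 (stepZero m d x y).2 = p) :
    Reaches (colorMap (routeE m) 0) (nodeZero m 0 x y) (nodeZero m 0 p.1 p.2) := by
  subst hp
  exact Reaches.head (colorMap_nodeZero d x y h)
    (reaches_returnZero hm6 (stepZero_lt d hx hy).1 (stepZero_lt d hx hy).2)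

theorem reaches_nodeTwo (hm6 : 6 ≤ m) (d : Fin 3) {x y : ℕ} (hx : x < m) (hy : y < m)
    (h : routeE m (nodeTwo m 0 x y) 2 = d) {p : ℕ × ℕ}
    (hp : returnTwo m (stepTwo m d x y).1 (stepTwo m d x y).2 = p) :
    Reaches (colorMap (routeE m) 2) (nodeTwo m 0 x y) (nodeTwo m 0 p.1 p.2) := by
  subst hp
  exact Reaches.head (colorMap_nodeTwo d x y h)
    (reaches_returnTwo hm6 (stepTwo_lt d hx hy).1 (stepTwo_lt d hx hy).2)

theorem reaches_nodeOne (hm6 : 6 ≤ m) (d : Fin 3) {x y : ℕ}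
    (h : routeE m (nodeOne m 0 x y) 1 = d) {p : ℕ × ℕ}
    (hp : (inc m (stepOne m d x y).1, (stepOne m d x y).2) = p) :
    Reaches (colorMap (routeE m) 1) (nodeOne m 0 x y) (nodeOne m 0 p.1 p.2) := by
  subst hp
  exact Reaches.head (colorMap_nodeOne d x y h) (reaches_returnOne hm6 _ _)

end RouteE

/-! ### The return maps as explicit tables. -/

namespace RouteE

variable {m : ℕ}

/-- Layer-`0` return map of color `0` in the coordinates `(j, k)`, first case. -/
def tableZeroI (m : ℕ) (p : ℕ × ℕ) : ℕ × ℕ :=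
  if p.1 = 0 ∧ p.2 = 0 then (2, 0)
  else if p.1 = 0 ∧ p.2 = 1 then (1, 1)
  else if p.1 = 0 ∧ p.2 = m - 1 then (0, 2)
  else if p.1 = 1 ∧ p.2 = 1 then (1, 2)
  else if p.1 = 1 ∧ p.2 = m - 1 then (1, 0)
  else if p.1 = 2 ∧ p.2 = 0 then (2, 2)
  else if 3 ≤ p.1 ∧ p.2 = 0 then (p.1, 1)
  else if p.1 = m - 1 then (0, if p.2 = m - 1 then 1 else if p.2 = m - 2 then 0 else p.2 + 2)
  else (p.1 + 1, inc m p.2)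

/-- Layer-`0` return map of color `0` in the coordinates `(j, k)`, second case. -/
def tableZeroII (m : ℕ) (p : ℕ × ℕ) : ℕ × ℕ :=
  if p.1 = 0 ∧ p.2 = 0 then (2, 0)
  else if p.1 = 0 ∧ p.2 = 1 then (1, 1)
  else if p.1 = 0 ∧ p.2 = m - 2 then (0, 1)
  else if p.1 = 0 ∧ p.2 = m - 1 then (0, 2)
  else if p.1 = 1 ∧ p.2 = 1 then (1, 2)
  else if p.1 = 1 ∧ p.2 = m - 2 then (1, m - 1)
  else if p.1 = 1 ∧ p.2 = m - 1 then (1, 0)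
  else if p.1 = 2 ∧ p.2 = 0 then (2, 2)
  else if 2 ≤ p.1 ∧ p.1 + p.2 = m - 1 then (p.1, p.2 + 2)
  else if 3 ≤ p.1 ∧ p.2 = 0 then (p.1, 1)
  else if p.1 = m - 1 then
    (if p.2 = m - 1 then (m - 1, 1) else (0, if p.2 = m - 2 then 0 else p.2 + 2))
  else (p.1 + 1, inc m p.2)

/-- Layer-`0` return map of color `1` in the coordinates `(i, k)`, first case. -/
def tableOneI (m : ℕ) (p : ℕ × ℕ) : ℕ × ℕ :=
  if p.1 = 0 ∧ p.2 = 0 then (2, 0)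
  else if p.1 = 0 ∧ p.2 ≤ m - 2 then (1, p.2)
  else if p.1 = 1 ∧ p.2 = m - 1 then (2, m - 1)
  else if 1 ≤ p.1 ∧ p.1 ≤ m - 3 ∧ p.1 + p.2 = m - 1 then (p.1 + 2, p.2)
  else if p.1 = m - 2 ∧ p.2 = 0 then (0, 0)
  else if p.1 = m - 2 ∧ p.2 = 1 then (m - 1, 1)
  else if p.1 = m - 1 ∧ p.2 = m - 1 then (1, m - 1)
  else (inc m p.1, inc m p.2)

/-- Layer-`0` return map of color `1` in the coordinates `(i, k)`, second case. -/
def tableOneII (m : ℕ) (p : ℕ × ℕ) : ℕ × ℕ :=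
  if p.1 = 0 ∧ p.2 = 0 then (2, 0)
  else if p.1 = 0 ∧ p.2 ≤ m - 2 then (1, p.2)
  else if p.1 = 1 ∧ p.2 = 0 then (3, 0)
  else if p.1 = 1 then (2, p.2)
  else if p.1 = 2 ∧ m - 2 ≤ p.2 then (3, p.2)
  else if 2 ≤ p.1 ∧ p.1 ≤ m - 3 ∧ p.1 + p.2 = m - 1 then (p.1 + 2, p.2)
  else if p.1 = m - 2 ∧ p.2 = 0 then (0, 0)
  else if p.1 = m - 2 ∧ p.2 = 1 then (m - 1, 1)
  else if p.1 = m - 1 ∧ p.2 = m - 1 then (1, m - 1)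
  else (inc m p.1, inc m p.2)

/-- Layer-`0` return map of color `2` in the coordinates `(i, j)`. -/
def tableTwo (m : ℕ) (p : ℕ × ℕ) : ℕ × ℕ :=
  if p.1 = 0 ∧ p.2 = 0 then (1, 0)
  else if p.1 = m - 1 ∧ p.2 = 0 then (m - 1, 2)
  else if p.1 = m - 1 ∧ p.2 = 2 then (m - 1, 3)
  else if p.1 = m - 1 then (0, p.2)
  else if p.2 = 1 then (p.1, 2)
  else if p.1 = 1 ∧ p.2 = m - 1 then (1, 1)
  else if p.1 = 2 ∧ p.2 = m - 2 then (3, 0)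
  else if p.2 = m - 1 then (inc m (p.1 + 1), 0)
  else if 3 ≤ p.1 ∧ p.1 + p.2 = m then (p.1, p.2 + 2)
  else (p.1 + 1, p.2 + 1)

theorem return_dirZeroI (hm6 : 6 ≤ m) {x y : ℕ} (hx : x < m) (hy : y < m) :
    returnZero m (stepZero m (dirZeroI m x y) x y).1 (stepZero m (dirZeroI m x y) x y).2 =
      tableZeroI m (x, y) := by
  unfold dirZeroI
  split_ifs with A B <;> simp only [Matrix.cons_val, tableZeroI, stepZero, returnZero, inc] <;> grind (splits := 30)

theorem return_dirZeroII (hm6 : 6 ≤ m) (h4 : m % 6 = 4) {x y : ℕ} (hx : x < m) (hy : y < m) :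
    returnZero m (stepZero m (dirZeroII m x y) x y).1 (stepZero m (dirZeroII m x y) x y).2 =
      tableZeroII m (x, y) := by
  unfold dirZeroII
  split_ifs with A B <;> simp only [Matrix.cons_val, tableZeroII, stepZero, returnZero, inc] <;> grind (splits := 30)

theorem return_dirOneI (hm6 : 6 ≤ m) {x y : ℕ} (hx : x < m) (hy : y < m) :
    (inc m (stepOne m (dirOneI m x y) x y).1, (stepOne m (dirOneI m x y) x y).2) =
      tableOneI m (x, y) := by
  unfold dirOneI
  split_ifs with A B <;> simp only [Matrix.cons_val, tableOneI, stepOne, inc] <;> grind (splits := 30)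

theorem return_dirOneII (hm6 : 6 ≤ m) (h4 : m % 6 = 4) {x y : ℕ} (hx : x < m) (hy : y < m) :
    (inc m (stepOne m (dirOneII m x y) x y).1, (stepOne m (dirOneII m x y) x y).2) =
      tableOneII m (x, y) := by
  unfold dirOneII
  split_ifs with A B <;> simp only [Matrix.cons_val, tableOneII, stepOne, inc] <;> grind (splits := 30)

theorem return_dirTwo (hm6 : 6 ≤ m) {x y : ℕ} (hx : x < m) (hy : y < m) :
    returnTwo m (stepTwo m (dirTwo m x y) x y).1 (stepTwo m (dirTwo m x y) x y).2 =
      tableTwo m (x, y) := by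
  unfold dirTwo
  split_ifs with A B <;> simp only [Matrix.cons_val, tableTwo, stepTwo, returnTwo, inc] <;> grind (splits := 30)

end RouteE

/-! ### Descent to a section, and diagonal runs. -/

/-- Strong induction on `μ`: an orbit on which `μ` drops until `s` holds must meet `s`. -/
theorem Reaches.exists_of_measure {α : Type*} {f : α → α} {P s : α → Prop} (μ : α → ℕ)
    (hP : ∀ a, P a → P (f a)) (h : ∀ a, P a → ¬ s a → μ (f a) < μ a) (a : α) (ha : P a) :
    ∃ b, P b ∧ s b ∧ Reaches f a b := by
  induction hn : μ a using Nat.strong_induction_on generalizing a with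
  | _ n ih =>
    subst hn
    by_cases hs : s a
    · exact ⟨a, ha, hs, Reaches.refl f a⟩
    · obtain ⟨b, hb, hsb, hab⟩ := ih _ (h a ha hs) (f a) (hP a ha) rfl
      exact ⟨b, hb, hsb, Reaches.head rfl hab⟩

theorem Reaches.diagonal {T : ℕ × ℕ → ℕ × ℕ} {x y x' y' n : ℕ} (hx : x + n = x')
    (hy : y + n = y') (h : ∀ t < n, T (x + t, y + t) = (x + t + 1, y + t + 1)) :
    Reaches T (x, y) (x', y') := by
  subst hx hy
  induction n with
  | zero => exact Reaches.refl _ _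
  | succ n ih => exact Reaches.tail (ih fun t ht => h t (by omega)) (h n (by omega))

/-! ### Color 0, first case: the line `j = 0`. -/

namespace RouteE

variable {m M : ℕ}

theorem tableZeroI_lt (hm6 : 6 ≤ m) (p : ℕ × ℕ) (hp : p.1 < m ∧ p.2 < m) :
    (tableZeroI m p).1 < m ∧ (tableZeroI m p).2 < m := by
  simp only [tableZeroI, inc]; split_ifs <;> omega

theorem tableZeroI_diagonal {x y x' y' : ℕ} (n : ℕ)
    (h : x + n = x' ∧ y + n = y' ∧ x' + 1 ≤ m ∧ y' + 1 ≤ m ∧ 1 ≤ x ∧ 1 ≤ y ∧ ¬ (x = 1 ∧ y = 1)) :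
    Reaches (tableZeroI m) (x, y) (x', y') := by
  refine Reaches.diagonal h.1 h.2.1 fun t ht => ?_
  simp only [tableZeroI, inc]
  grind

theorem tableZeroI_section_one (hm6 : 6 ≤ m) :
    Reaches (tableZeroI m) (0, 1) (0, 3) := by
  refine Reaches.head (b := (1, 1)) (by grind [tableZeroI, inc]) ?_
  refine Reaches.head (b := (1, 2)) (by grind [tableZeroI, inc]) ?_
  refine Reaches.trans (tableZeroI_diagonal (x' := m - 2) (y' := m - 1) (m - 3)
    (by omega)) ?_
  refine Reaches.head (b := (m - 1, 0)) (by grind [tableZeroI, inc]) ?_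
  refine Reaches.head (b := (m - 1, 1)) (by grind [tableZeroI, inc]) ?_
  exact Reaches.single (by grind [tableZeroI, inc])

/-- Two defects in one lap: the pause on `k = 0` raises `k` by 1 without moving `j`, and the exit at
`j = m - 1` adds 2 to `k` instead of 1. -/
theorem tableZeroI_section {k : ℕ} (hk : 2 ≤ k) (hkm : k + 3 ≤ m) :
    Reaches (tableZeroI m) (0, k) (0, k + 2) := by
  refine Reaches.head (b := (1, k + 1)) (by grind [tableZeroI, inc]) ?_
  refine Reaches.trans (tableZeroI_diagonal (x' := m - 1 - k) (y' := m - 1) (m - 2 - k)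
    (by omega)) ?_
  refine Reaches.head (b := (m - k, 0)) (by grind (splits := 30) [tableZeroI, inc]) ?_
  refine Reaches.head (b := (m - k, 1)) (by grind [tableZeroI, inc]) ?_
  refine Reaches.trans (tableZeroI_diagonal (x' := m - 1) (y' := k) (k - 1)
    (by omega)) ?_
  exact Reaches.single (by grind [tableZeroI, inc])

theorem tableZeroI_section_neg_two (hm6 : 6 ≤ m) :
    Reaches (tableZeroI m) (0, m - 2) (0, 0) := by
  refine Reaches.head (b := (1, m - 1)) (by grind [tableZeroI, inc]) ?_
  refine Reaches.head (b := (1, 0)) (by grind [tableZeroI, inc]) ?_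
  refine Reaches.head (b := (2, 1)) (by grind [tableZeroI, inc]) ?_
  refine Reaches.trans (tableZeroI_diagonal (x' := m - 1) (y' := m - 2) (m - 3)
    (by omega)) ?_
  exact Reaches.single (by grind [tableZeroI, inc])

theorem tableZeroI_section_neg_one (hm6 : 6 ≤ m) :
    Reaches (tableZeroI m) (0, m - 1) (0, 2) := by
  exact Reaches.single (by grind [tableZeroI, inc])

theorem tableZeroI_section_reaches_even (hm6 : 6 ≤ m) (n k : ℕ)
    (h : k + 2 * n + 2 = m) (hk : 2 ≤ k) : Reaches (tableZeroI m) (0, k) (0, 0) := by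
  induction n generalizing k with
  | zero =>
    obtain rfl : k = m - 2 := by omega
    exact tableZeroI_section_neg_two hm6
  | succ n ih =>
    exact (tableZeroI_section hk (by omega)).trans (ih (k + 2) (by omega) (by omega))

/-- Odd points climb to `m - 1`, which jumps to 2 and so joins the even chain. -/
theorem tableZeroI_section_reaches_odd (hm6 : 6 ≤ m) (hm : m = M + M) (n k : ℕ)
    (h : k + 2 * n + 1 = m) (hk : 1 ≤ k) : Reaches (tableZeroI m) (0, k) (0, 0) := by
  induction n generalizing k with
  | zero =>
    obtain rfl : k = m - 1 := by omega
    exact (tableZeroI_section_neg_one hm6).trans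
      (tableZeroI_section_reaches_even hm6 (M - 2) 2 (by omega) le_rfl)
  | succ n ih =>
    by_cases h1 : k = 1
    · subst h1
      exact (tableZeroI_section_one hm6).trans (ih 3 (by omega) (by omega))
    · exact (tableZeroI_section (by omega) (by omega)).trans (ih (k + 2) (by omega) (by omega))

theorem tableZeroI_reaches (hm6 : 6 ≤ m) (hm : Even m) (p : ℕ × ℕ) (hp : p.1 < m ∧ p.2 < m) :
    Reaches (tableZeroI m) p (0, 0) := by
  obtain ⟨M, hM⟩ := hm
  -- Most steps raise `j`. Where `j` pauses, `k` passes along `m - 1`, 0, 1, then larger values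
  -- (possibly skipping some), which the bonus orders; the factor 5 outweighs any change of bonus.
  obtain ⟨⟨j, k⟩, hq, hj, h⟩ := Reaches.exists_of_measure (f := tableZeroI m)
    (P := fun p => p.1 < m ∧ p.2 < m) (s := fun p => p.1 = 0)
    (fun p => if p.1 = 0 then 0 else 5 * (m - p.1) +
      (if p.2 = m - 1 then 3 else if p.2 = 0 then 2 else if p.2 = 1 then 1 else 0))
    (tableZeroI_lt hm6) (by
      rintro ⟨j, k⟩ ⟨hj, hk⟩ hs
      simp only [tableZeroI, inc] at *
      grind (splits := 30)) p hp
  refine h.trans ?_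
  simp only at hj hq
  subst hj
  rcases Nat.eq_zero_or_pos k with rfl | hk
  · exact Reaches.refl _ _
  rcases Nat.even_or_odd' k with ⟨u, hu | hu⟩
  · exact tableZeroI_section_reaches_even hm6 (M - u - 1) k (by omega) (by omega)
  · exact tableZeroI_section_reaches_odd hm6 hM (M - u - 1) k (by omega) (by omega)

end RouteE

/-! ### Color 0, second case: the line `j = 0`. -/

namespace RouteE

variable {m M : ℕ}

theorem tableZeroII_lt (hm6 : 6 ≤ m) (p : ℕ × ℕ) (hp : p.1 < m ∧ p.2 < m) :
    (tableZeroII m p).1 < m ∧ (tableZeroII m p).2 < m := by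
  simp only [tableZeroII, inc]; grind (splits := 30)

/-- The hypothesis `hs` keeps the run off the antidiagonal `j + k = m - 1` before its endpoint. It
is automatic when `x + y` is even, since `m - 1` is odd in the applications. -/
theorem tableZeroII_diagonal {x y x' y' : ℕ} (n : ℕ)
    (h : x + n = x' ∧ y + n = y' ∧ x' + 1 ≤ m ∧ y' + 1 ≤ m ∧ 1 ≤ x ∧ 1 ≤ y ∧ ¬ (x = 1 ∧ y = 1))
    (hs : ∀ t < n, x + y + 2 * t + 1 ≠ m) :
    Reaches (tableZeroII m) (x, y) (x', y') := by
  refine Reaches.diagonal h.1 h.2.1 fun t ht => ?_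
  have := hs t ht
  simp only [tableZeroII, inc]
  repeat first | rw [if_pos (by omega)] | rw [if_neg (by omega)]

/-- The coordinate sum is odd at first, so the run meets the antidiagonal and `k` gains 2. With the
pause on `k = 0` and the exit this makes the shift 4. Starting at `j = 1` lets the exceptional route
from `(0, 1)` share the argument. -/
theorem tableZeroII_odd_aux {u : ℕ} (hM : m = M + M) (hu : u + 3 ≤ M) :
    Reaches (tableZeroII m) (1, 2 * u + 2) (0, 2 * u + 5) := by
  refine Reaches.trans (tableZeroII_diagonal (x' := M - 1 - u) (y' := M + u) (M - 2 - u)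
    (by omega) (by omega)) ?_
  refine Reaches.head (b := (M - 1 - u, M + u + 2)) (by grind (splits := 30) [tableZeroII, inc]) ?_
  refine Reaches.trans (tableZeroII_diagonal (x' := m - 4 - 2 * u) (y' := m - 1) (M - u - 3)
    (by omega) (by omega)) ?_
  refine Reaches.head (b := (m - 3 - 2 * u, 0)) (by grind (splits := 30) [tableZeroII, inc]) ?_
  refine Reaches.head (b := (m - 3 - 2 * u, 1)) (by grind [tableZeroII, inc]) ?_
  refine Reaches.trans (tableZeroII_diagonal (x' := m - 1) (y' := 2 * u + 3) (2 * u + 2)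
    (by omega) (by omega)) ?_
  exact Reaches.single (by grind [tableZeroII, inc])

theorem tableZeroII_section_one (hm10 : 10 ≤ m) (hM : m = M + M) :
    Reaches (tableZeroII m) (0, 1) (0, 5) := by
  refine Reaches.head (b := (1, 1)) (by grind [tableZeroII, inc]) ?_
  refine Reaches.head (b := (1, 2)) (by grind [tableZeroII, inc]) ?_
  exact tableZeroII_odd_aux (u := 0) hM (by omega)

theorem tableZeroII_section_odd {u : ℕ} (hM : m = M + M) (hu : u + 3 ≤ M) (hu1 : 1 ≤ u) :
    Reaches (tableZeroII m) (0, 2 * u + 1) (0, 2 * u + 5) := by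
  refine Reaches.head (b := (1, 2 * u + 2)) (by grind [tableZeroII, inc]) ?_
  exact tableZeroII_odd_aux hM hu

theorem tableZeroII_section_neg_three (hm10 : 10 ≤ m) (hM : m = M + M) :
    Reaches (tableZeroII m) (0, m - 3) (0, 4) := by
  refine Reaches.head (b := (1, m - 2)) (by grind [tableZeroII, inc]) ?_
  refine Reaches.head (b := (1, m - 1)) (by grind [tableZeroII, inc]) ?_
  refine Reaches.head (b := (1, 0)) (by grind [tableZeroII, inc]) ?_
  refine Reaches.head (b := (2, 1)) (by grind [tableZeroII, inc]) ?_
  refine Reaches.trans (tableZeroII_diagonal (x' := M) (y' := M - 1) (M - 2)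
    (by omega) (by omega)) ?_
  refine Reaches.head (b := (M, M + 1)) (by grind (splits := 30) [tableZeroII, inc]) ?_
  refine Reaches.trans (tableZeroII_diagonal (x' := m - 2) (y' := m - 1) (M - 2)
    (by omega) (by omega)) ?_
  refine Reaches.head (b := (m - 1, 0)) (by grind (splits := 30) [tableZeroII, inc]) ?_
  refine Reaches.head (b := (m - 1, 2)) (by grind [tableZeroII, inc]) ?_
  exact Reaches.single (by grind [tableZeroII, inc])

/-- The antidiagonal is now met only after the pause on `k = 0` has changed the parity of the sum.
Stopping at `j = m - 1` leaves open whether the exit wraps to 0. -/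
theorem tableZeroII_even_aux {u : ℕ} (hM : m = M + M) (hu : u + 2 ≤ M) (hu1 : 1 ≤ u) :
    Reaches (tableZeroII m) (0, 2 * u) (m - 1, 2 * u + 2) := by
  refine Reaches.head (b := (1, 2 * u + 1)) (by grind [tableZeroII, inc]) ?_
  refine Reaches.trans (tableZeroII_diagonal (x' := m - 1 - 2 * u) (y' := m - 1) (m - 2 - 2 * u)
    (by omega) (by omega)) ?_
  refine Reaches.head (b := (m - 2 * u, 0)) (by grind (splits := 30) [tableZeroII, inc]) ?_
  refine Reaches.head (b := (m - 2 * u, 1)) (by grind [tableZeroII, inc]) ?_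
  refine Reaches.trans (tableZeroII_diagonal (x' := m - u - 1) (y' := u) (u - 1)
    (by omega) (by omega)) ?_
  refine Reaches.head (b := (m - u - 1, u + 2)) (by grind (splits := 30) [tableZeroII, inc]) ?_
  refine Reaches.trans (tableZeroII_diagonal (x' := m - 1) (y' := 2 * u + 2) (u)
    (by omega) (by omega)) ?_
  exact Reaches.refl _ _

theorem tableZeroII_section_even {u : ℕ} (hM : m = M + M) (hu : u + 3 ≤ M) (hu1 : 1 ≤ u) :
    Reaches (tableZeroII m) (0, 2 * u) (0, 2 * u + 4) := by
  exact (tableZeroII_even_aux hM (by omega) hu1).tail (by simp only [tableZeroII, inc]; grind)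

theorem tableZeroII_section_neg_four (hm10 : 10 ≤ m) (hM : m = M + M) :
    Reaches (tableZeroII m) (0, m - 4) (0, 0) := by
  have h := tableZeroII_even_aux (u := M - 2) hM (by omega) (by omega)
  rw [show 2 * (M - 2) = m - 4 by omega] at h
  exact h.tail (by simp only [tableZeroII, inc]; grind)

theorem tableZeroII_section_neg_two (hm10 : 10 ≤ m) :
    Reaches (tableZeroII m) (0, m - 2) (0, 1) := by
  exact Reaches.single (by grind [tableZeroII, inc])

theorem tableZeroII_section_neg_one (hm10 : 10 ≤ m) :
    Reaches (tableZeroII m) (0, m - 1) (0, 2) := by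
  exact Reaches.single (by grind [tableZeroII, inc])

theorem tableZeroII_section (hm10 : 10 ≤ m) (hM : m = M + M) {k : ℕ} (hk : 1 ≤ k)
    (hkm : k + 5 ≤ m) : Reaches (tableZeroII m) (0, k) (0, k + 4) := by
  rcases Nat.even_or_odd' k with ⟨u, rfl | rfl⟩
  · exact tableZeroII_section_even hM (by omega) (by omega)
  · rcases Nat.eq_zero_or_pos u with rfl | hu
    · exact tableZeroII_section_one hm10 hM
    · exact tableZeroII_section_odd hM (by omega) hu

theorem tableZeroII_section_iterate (hm10 : 10 ≤ m) (hM : m = M + M) (n : ℕ) {k l : ℕ}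
    (hk : 1 ≤ k) (hkl : k + 4 * n = l) (hl : l + 1 ≤ m) :
    Reaches (tableZeroII m) (0, k) (0, l) := by
  induction n generalizing k with
  | zero => exact Reaches.of_eq (by rw [← hkl]; rfl)
  | succ n ih =>
    exact (tableZeroII_section hm10 hM hk (by omega)).trans (ih (by omega) (by omega))

theorem tableZeroII_section_reaches (hm10 : 10 ≤ m) (hM : m = M + M) (k : ℕ) (hk : k < m) :
    Reaches (tableZeroII m) (0, k) (0, 0) := by
  have h4 : ∀ k, 1 ≤ k → k < m → k % 4 = m % 4 → Reaches (tableZeroII m) (0, k) (0, 0) :=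
    fun k h1 hkm h => (tableZeroII_section_iterate hm10 hM ((m - 4 - k) / 4) h1
      (by omega) (by omega)).trans (tableZeroII_section_neg_four hm10 hM)
  have h3 : ∀ k, 1 ≤ k → k < m → (k + 3) % 4 = m % 4 → Reaches (tableZeroII m) (0, k) (0, 4) :=
    fun k h1 hkm h => (tableZeroII_section_iterate hm10 hM ((m - 3 - k) / 4) h1
      (by omega) (by omega)).trans (tableZeroII_section_neg_three hm10 hM)
  have h2 : ∀ k, 1 ≤ k → k < m → (k + 2) % 4 = m % 4 → Reaches (tableZeroII m) (0, k) (0, 1) :=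
    fun k h1 hkm h => (tableZeroII_section_iterate hm10 hM ((m - 2 - k) / 4) h1
      (by omega) (by omega)).trans (tableZeroII_section_neg_two hm10)
  have h1 : ∀ k, 1 ≤ k → k < m → (k + 1) % 4 = m % 4 → Reaches (tableZeroII m) (0, k) (0, 2) :=
    fun k h1 hkm h => (tableZeroII_section_iterate hm10 hM ((m - 1 - k) / 4) h1
      (by omega) (by omega)).trans (tableZeroII_section_neg_one hm10)
  rcases Nat.eq_zero_or_pos k with rfl | hk1
  · exact Reaches.refl _ _
  have hm4 : m % 4 = 0 ∨ m % 4 = 2 := by omega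
  have hcl : k % 4 = m % 4 ∨ (k + 3) % 4 = m % 4 ∨ (k + 2) % 4 = m % 4 ∨ (k + 1) % 4 = m % 4 := by
    omega
  -- Modulo 4 the classes are linked as 3, 2, 1, 0 if `m ≡ 0`, and as 3, 0, 1, 2 if `m ≡ 2`; the
  -- last class leads to the point 0.
  rcases hm4 with hm4 | hm4
  · have r4 := h4 4 (by omega) (by omega) (by omega)
    have r1 := (h3 1 (by omega) (by omega) (by omega)).trans r4
    have r2 := (h2 2 (by omega) (by omega) (by omega)).trans r1
    rcases hcl with h | h | h | h
    · exact h4 k hk1 hk h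
    · exact (h3 k hk1 hk h).trans r4
    · exact (h2 k hk1 hk h).trans r1
    · exact (h1 k hk1 hk h).trans r2
  · have r2 := h4 2 (by omega) (by omega) (by omega)
    have r1 := (h1 1 (by omega) (by omega) (by omega)).trans r2
    have r4 := (h2 4 (by omega) (by omega) (by omega)).trans r1
    rcases hcl with h | h | h | h
    · exact h4 k hk1 hk h
    · exact (h3 k hk1 hk h).trans r4
    · exact (h2 k hk1 hk h).trans r1
    · exact (h1 k hk1 hk h).trans r2

theorem tableZeroII_reaches (hm10 : 10 ≤ m) (hm : Even m) (p : ℕ × ℕ) (hp : p.1 < m ∧ p.2 < m) :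
    Reaches (tableZeroII m) p (0, 0) := by
  obtain ⟨M, hM⟩ := hm
  -- As in the first case, with further pauses of `j` on the antidiagonal and at `(1, m - 2)` and
  -- `(m - 1, m - 1)`; every bonus is below 5.
  obtain ⟨⟨j, k⟩, hq, hj, h⟩ := Reaches.exists_of_measure (f := tableZeroII m)
    (P := fun p => p.1 < m ∧ p.2 < m) (s := fun p => p.1 = 0)
    (fun p => if p.1 = 0 then 0 else 5 * (m - p.1) +
      (if p.1 = 1 ∧ p.2 = m - 2 then 4
      else if (p.1 = 1 ∨ p.1 = m - 1) ∧ p.2 = m - 1 then 3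
      else if p.2 = 0 then 2
      else if (p.1 = 1 ∧ p.2 = 1) ∨ (2 ≤ p.1 ∧ p.1 + p.2 = m - 1) then 1 else 0))
    (tableZeroII_lt (by omega)) (by
      rintro ⟨j, k⟩ ⟨hj, hk⟩ hs
      simp only [tableZeroII, inc] at *
      grind (splits := 30)) p hp
  refine h.trans ?_
  simp only at hj hq
  subst hj
  exact tableZeroII_section_reaches hm10 hM k hq.2

end RouteE

/-! ### Color 1, first case: the line `k = 0`. -/

namespace RouteE

variable {m M : ℕ}

theorem tableOneI_lt (hm6 : 6 ≤ m) (p : ℕ × ℕ) (hp : p.1 < m ∧ p.2 < m) :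
    (tableOneI m p).1 < m ∧ (tableOneI m p).2 < m := by
  simp only [tableOneI, inc]; grind (splits := 30)

theorem tableOneI_diagonal {x y x' y' : ℕ} (n : ℕ)
    (h : x + n = x' ∧ y + n = y' ∧ x' + 1 ≤ m ∧ y' + 1 ≤ m ∧ 1 ≤ x ∧ ¬ (x + 2 = m ∧ y = 0))
    (hs : ∀ t < n, x + y + 2 * t + 1 ≠ m) :
    Reaches (tableOneI m) (x, y) (x', y') := by
  refine Reaches.diagonal h.1 h.2.1 fun t ht => ?_
  have := hs t ht
  simp only [tableOneI, inc]
  repeat first | rw [if_pos (by omega)] | rw [if_neg (by omega)]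

theorem tableOneI_section_neg_two (hm6 : 6 ≤ m) :
    Reaches (tableOneI m) (m - 2, 0) (0, 0) := by
  exact Reaches.single (by grind [tableOneI, inc])

theorem tableOneI_section_odd {u : ℕ} (hM : m = M + M) (hu : u + 3 ≤ M) :
    Reaches (tableOneI m) (2 * u + 1, 0) (2 * u + 4, 0) := by
  refine Reaches.trans (tableOneI_diagonal (x' := M + u) (y' := M - 1 - u) (M - 1 - u)
    (by omega) (by omega)) ?_
  refine Reaches.head (b := (M + u + 2, M - 1 - u)) (by grind (splits := 30) [tableOneI, inc]) ?_
  refine Reaches.trans (tableOneI_diagonal (x' := m - 1) (y' := m - 2 * u - 4) (M - u - 3)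
    (by omega) (by omega)) ?_
  refine Reaches.head (b := (0, m - 2 * u - 3)) (by grind [tableOneI, inc]) ?_
  refine Reaches.head (b := (1, m - 2 * u - 3)) (by grind [tableOneI, inc]) ?_
  refine Reaches.trans (tableOneI_diagonal (x' := 2 * u + 3) (y' := m - 1) (2 * u + 2)
    (by omega) (by omega)) ?_
  exact Reaches.single (by grind [tableOneI, inc])

theorem tableOneI_section_even {u : ℕ} (hM : m = M + M) (hu : u + 2 ≤ M) (hu1 : 1 ≤ u) :
    Reaches (tableOneI m) (2 * u, 0) (2 * u + 3, 0) := by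
  refine Reaches.trans (tableOneI_diagonal (x' := m - 1) (y' := m - 1 - 2 * u) (m - 1 - 2 * u)
    (by omega) (by omega)) ?_
  refine Reaches.head (b := (0, m - 2 * u)) (by grind [tableOneI, inc]) ?_
  refine Reaches.head (b := (1, m - 2 * u)) (by grind [tableOneI, inc]) ?_
  refine Reaches.trans (tableOneI_diagonal (x' := u) (y' := m - u - 1) (u - 1)
    (by omega) (by omega)) ?_
  refine Reaches.head (b := (u + 2, m - u - 1)) (by grind [tableOneI, inc]) ?_
  refine Reaches.trans (tableOneI_diagonal (x' := 2 * u + 2) (y' := m - 1) (u)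
    (by omega) (by omega)) ?_
  exact Reaches.single (by grind [tableOneI, inc])

theorem tableOneI_section_neg_three (hm6 : 6 ≤ m) (hM : m = M + M) :
    Reaches (tableOneI m) (m - 3, 0) (1, 0) := by
  refine Reaches.head (b := (m - 2, 1)) (by grind [tableOneI, inc]) ?_
  refine Reaches.head (b := (m - 1, 1)) (by grind [tableOneI, inc]) ?_
  refine Reaches.head (b := (0, 2)) (by grind [tableOneI, inc]) ?_
  refine Reaches.head (b := (1, 2)) (by grind [tableOneI, inc]) ?_
  refine Reaches.trans (tableOneI_diagonal (x' := M - 1) (y' := M) (M - 2)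
    (by omega) (by omega)) ?_
  refine Reaches.head (b := (M + 1, M)) (by grind (splits := 30) [tableOneI, inc]) ?_
  refine Reaches.trans (tableOneI_diagonal (x' := m - 1) (y' := m - 2) (M - 2)
    (by omega) (by omega)) ?_
  refine Reaches.head (b := (0, m - 1)) (by grind [tableOneI, inc]) ?_
  exact Reaches.single (by grind [tableOneI, inc])

theorem tableOneI_section_neg_one (hm6 : 6 ≤ m) (hM : m = M + M) :
    Reaches (tableOneI m) (m - 1, 0) (3, 0) := by
  refine Reaches.head (b := (0, 1)) (by grind [tableOneI, inc]) ?_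
  refine Reaches.head (b := (1, 1)) (by grind [tableOneI, inc]) ?_
  refine Reaches.trans (tableOneI_diagonal (x' := m - 1) (y' := m - 1) (m - 2)
    (by omega) (by omega)) ?_
  refine Reaches.head (b := (1, m - 1)) (by grind [tableOneI, inc]) ?_
  refine Reaches.head (b := (2, m - 1)) (by grind [tableOneI, inc]) ?_
  exact Reaches.single (by grind [tableOneI, inc])

/-- A lap gains 1 at `i = 0`, where `k` pauses, and 2 on the antidiagonal `i + k = m - 1`. The
latter is met exactly once: before the pause for odd `i`, after it for even `i`. -/
theorem tableOneI_section (hM : m = M + M) {i : ℕ} (hi : 1 ≤ i)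
    (him : i + 4 ≤ m) : Reaches (tableOneI m) (i, 0) (i + 3, 0) := by
  rcases Nat.even_or_odd' i with ⟨u, rfl | rfl⟩
  · exact tableOneI_section_even hM (by omega) (by omega)
  · exact tableOneI_section_odd hM (by omega)

theorem tableOneI_section_iterate (hM : m = M + M) (n : ℕ) {k l : ℕ}
    (hk : 1 ≤ k) (hkl : k + 3 * n = l) (hl : l + 1 ≤ m) :
    Reaches (tableOneI m) (k, 0) (l, 0) := by
  induction n generalizing k with
  | zero => exact Reaches.of_eq (by rw [← hkl]; rfl)
  | succ n ih =>
    exact (tableOneI_section hM hk (by omega)).trans (ih (by omega) (by omega))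

theorem tableOneI_section_reaches (hm6 : 6 ≤ m) (hM : m = M + M) (h4 : m % 6 ≠ 4) (k : ℕ)
    (hk : k < m) : Reaches (tableOneI m) (k, 0) (0, 0) := by
  have h3 : ∀ k, 1 ≤ k → k < m → k % 3 = m % 3 → Reaches (tableOneI m) (k, 0) (1, 0) :=
    fun k h1 hkm h => (tableOneI_section_iterate hM ((m - 3 - k) / 3) h1
      (by omega) (by omega)).trans (tableOneI_section_neg_three hm6 hM)
  have h2 : ∀ k, 1 ≤ k → k < m → (k + 2) % 3 = m % 3 → Reaches (tableOneI m) (k, 0) (0, 0) :=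
    fun k h1 hkm h => (tableOneI_section_iterate hM ((m - 2 - k) / 3) h1
      (by omega) (by omega)).trans (tableOneI_section_neg_two hm6)
  have h1 : ∀ k, 1 ≤ k → k < m → (k + 1) % 3 = m % 3 → Reaches (tableOneI m) (k, 0) (3, 0) :=
    fun k h1 hkm h => (tableOneI_section_iterate hM ((m - 1 - k) / 3) h1
      (by omega) (by omega)).trans (tableOneI_section_neg_one hm6 hM)
  rcases Nat.eq_zero_or_pos k with rfl | hk1
  · exact Reaches.refl _ _
  have hm3 : m % 3 = 0 ∨ m % 3 = 2 := by omega
  have hcl : k % 3 = m % 3 ∨ (k + 2) % 3 = m % 3 ∨ (k + 1) % 3 = m % 3 := by omega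
  -- Modulo 3 the classes are linked as 2, 0, 1 if `m ≡ 0`, and as 1, 0 with 2 leading to 1 if `m ≡
  -- 2`, except that here 1 is followed by 0, whose chain ends at the point 0.
  rcases hm3 with hm3 | hm3
  · have r1 := h2 1 (by omega) (by omega) (by omega)
    have r3 := (h3 3 (by omega) (by omega) (by omega)).trans r1
    rcases hcl with h | h | h
    · exact (h3 k hk1 hk h).trans r1
    · exact h2 k hk1 hk h
    · exact (h1 k hk1 hk h).trans r3
  · have r3 := h2 3 (by omega) (by omega) (by omega)
    have r1 := (h1 1 (by omega) (by omega) (by omega)).trans r3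
    rcases hcl with h | h | h
    · exact (h3 k hk1 hk h).trans r1
    · exact h2 k hk1 hk h
    · exact (h1 k hk1 hk h).trans r3

theorem tableOneI_reaches (hm6 : 6 ≤ m) (hm : Even m) (h4 : m % 6 ≠ 4) (p : ℕ × ℕ)
    (hp : p.1 < m ∧ p.2 < m) : Reaches (tableOneI m) p (0, 0) := by
  obtain ⟨M, hM⟩ := hm
  obtain ⟨⟨i, k⟩, hq, hj, h⟩ := Reaches.exists_of_measure (f := tableOneI m)
    (P := fun p => p.1 < m ∧ p.2 < m) (s := fun p => p.2 = 0)
    (fun p => if p.2 = 0 then 0 else 5 * (m - p.2) +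
      (if p.1 = m - 1 ∧ p.2 = m - 1 then 4
      else if p.1 = 0 then 3
      else if p.1 = 1 ∧ p.2 = m - 1 then 2
      else if p.1 + p.2 = m - 1 then 1 else 0))
    (tableOneI_lt hm6) (by
      rintro ⟨j, k⟩ ⟨hj, hk⟩ hs
      simp only [tableOneI, inc] at *
      grind (splits := 30)) p hp
  refine h.trans ?_
  simp only at hj hq
  subst hj
  exact tableOneI_section_reaches hm6 hM h4 i hq.1

end RouteE

/-! ### Color 1, second case: the line `k = 0`. -/

namespace RouteE

variable {m M : ℕ}

theorem tableOneII_lt (hm6 : 6 ≤ m) (p : ℕ × ℕ) (hp : p.1 < m ∧ p.2 < m) :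
    (tableOneII m p).1 < m ∧ (tableOneII m p).2 < m := by
  simp only [tableOneII, inc]; grind (splits := 30)

theorem tableOneII_diagonal {x y x' y' : ℕ} (n : ℕ)
    (h : x + n = x' ∧ y + n = y' ∧ x' + 1 ≤ m ∧ y' + 1 ≤ m ∧ 2 ≤ x ∧ ¬ (x = 2 ∧ y + 2 = m) ∧ ¬ (x + 2 = m ∧ y = 0))
    (hs : ∀ t < n, x + y + 2 * t + 1 ≠ m) :
    Reaches (tableOneII m) (x, y) (x', y') := by
  refine Reaches.diagonal h.1 h.2.1 fun t ht => ?_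
  have := hs t ht
  simp only [tableOneII, inc]
  repeat first | rw [if_pos (by omega)] | rw [if_neg (by omega)]

theorem tableOneII_section_one (hm10 : 10 ≤ m) :
    Reaches (tableOneII m) (1, 0) (3, 0) := by
  exact Reaches.single (by grind [tableOneII, inc])

theorem tableOneII_section_two (hm10 : 10 ≤ m) (hM : m = M + M) :
    Reaches (tableOneII m) (2, 0) (5, 0) := by
  refine Reaches.trans (tableOneII_diagonal (x' := m - 1) (y' := m - 3) (m - 3)
    (by omega) (by omega)) ?_
  refine Reaches.head (b := (0, m - 2)) (by grind [tableOneII, inc]) ?_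
  refine Reaches.head (b := (1, m - 2)) (by grind [tableOneII, inc]) ?_
  refine Reaches.head (b := (2, m - 2)) (by grind [tableOneII, inc]) ?_
  refine Reaches.head (b := (3, m - 2)) (by grind [tableOneII, inc]) ?_
  refine Reaches.head (b := (4, m - 1)) (by grind [tableOneII, inc]) ?_
  exact Reaches.single (by grind [tableOneII, inc])

theorem tableOneII_section_neg_two (hm10 : 10 ≤ m) :
    Reaches (tableOneII m) (m - 2, 0) (0, 0) := by
  exact Reaches.single (by grind [tableOneII, inc])

/-- Pauses of `k` at `i = 0` and `i = 1` preserve the parity of the coordinate sum modulo 2 taken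
together, so an odd start meets the antidiagonal both before and after them. The gain is 2 + 1 + 1 +
2 = 6. -/
theorem tableOneII_odd_aux {u : ℕ} (hM : m = M + M) (hu : u + 3 ≤ M) (hu1 : 1 ≤ u) :
    Reaches (tableOneII m) (2 * u + 1, 0) (u + 4, m - u - 3) := by
  refine Reaches.trans (tableOneII_diagonal (x' := M + u) (y' := M - 1 - u) (M - 1 - u)
    (by omega) (by omega)) ?_
  refine Reaches.head (b := (M + u + 2, M - 1 - u)) (by grind (splits := 30) [tableOneII, inc]) ?_
  refine Reaches.trans (tableOneII_diagonal (x' := m - 1) (y' := m - 2 * u - 4) (M - u - 3)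
    (by omega) (by omega)) ?_
  refine Reaches.head (b := (0, m - 2 * u - 3)) (by grind (splits := 30) [tableOneII, inc]) ?_
  refine Reaches.head (b := (1, m - 2 * u - 3)) (by grind [tableOneII, inc]) ?_
  refine Reaches.head (b := (2, m - 2 * u - 3)) (by grind [tableOneII, inc]) ?_
  refine Reaches.trans (tableOneII_diagonal (x' := u + 2) (y' := m - u - 3) (u)
    (by omega) (by omega)) ?_
  exact Reaches.single (by grind [tableOneII, inc])

theorem tableOneII_section_odd {u : ℕ} (hM : m = M + M) (hu : u + 4 ≤ M) (hu1 : 1 ≤ u) :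
    Reaches (tableOneII m) (2 * u + 1, 0) (2 * u + 7, 0) := by
  refine (tableOneII_odd_aux hM (by omega) hu1).trans ?_
  refine Reaches.trans (tableOneII_diagonal (x' := 2 * u + 6) (y' := m - 1) (u + 2)
    (by omega) (by omega)) ?_
  exact Reaches.single (by grind [tableOneII, inc])

theorem tableOneII_section_neg_five (hm10 : 10 ≤ m) (hM : m = M + M) :
    Reaches (tableOneII m) (m - 5, 0) (1, 0) := by
  have h := tableOneII_odd_aux (u := M - 3) hM (by omega) (by omega)
  rw [show 2 * (M - 3) + 1 = m - 5 by omega] at h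
  refine h.trans ?_
  refine Reaches.trans (tableOneII_diagonal (x' := m - 1) (y' := m - 2) (M - 2)
    (by omega) (by omega)) ?_
  refine Reaches.head (b := (0, m - 1)) (by grind [tableOneII, inc]) ?_
  exact Reaches.single (by grind [tableOneII, inc])

/-- An even start misses the antidiagonal on both runs, leaving only the two pauses. -/
theorem tableOneII_section_even {u : ℕ} (hM : m = M + M) (hu : u + 2 ≤ M) (hu1 : 2 ≤ u) :
    Reaches (tableOneII m) (2 * u, 0) (2 * u + 2, 0) := by
  refine Reaches.trans (tableOneII_diagonal (x' := m - 1) (y' := m - 1 - 2 * u) (m - 1 - 2 * u)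
    (by omega) (by omega)) ?_
  refine Reaches.head (b := (0, m - 2 * u)) (by grind (splits := 30) [tableOneII, inc]) ?_
  refine Reaches.head (b := (1, m - 2 * u)) (by grind [tableOneII, inc]) ?_
  refine Reaches.head (b := (2, m - 2 * u)) (by grind [tableOneII, inc]) ?_
  refine Reaches.trans (tableOneII_diagonal (x' := 2 * u + 1) (y' := m - 1) (2 * u - 1)
    (by omega) (by omega)) ?_
  exact Reaches.single (by grind [tableOneII, inc])

theorem tableOneII_section_neg_three (hm10 : 10 ≤ m) (hM : m = M + M) :
    Reaches (tableOneII m) (m - 3, 0) (4, 0) := by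
  refine Reaches.head (b := (m - 2, 1)) (by grind [tableOneII, inc]) ?_
  refine Reaches.head (b := (m - 1, 1)) (by grind [tableOneII, inc]) ?_
  refine Reaches.head (b := (0, 2)) (by grind [tableOneII, inc]) ?_
  refine Reaches.head (b := (1, 2)) (by grind [tableOneII, inc]) ?_
  refine Reaches.head (b := (2, 2)) (by grind [tableOneII, inc]) ?_
  refine Reaches.trans (tableOneII_diagonal (x' := m - 1) (y' := m - 1) (m - 3)
    (by omega) (by omega)) ?_
  refine Reaches.head (b := (1, m - 1)) (by grind [tableOneII, inc]) ?_
  refine Reaches.head (b := (2, m - 1)) (by grind [tableOneII, inc]) ?_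
  refine Reaches.head (b := (3, m - 1)) (by grind [tableOneII, inc]) ?_
  exact Reaches.single (by grind [tableOneII, inc])

theorem tableOneII_section_neg_one (hm10 : 10 ≤ m) (hM : m = M + M) :
    Reaches (tableOneII m) (m - 1, 0) (7, 0) := by
  refine Reaches.head (b := (0, 1)) (by grind [tableOneII, inc]) ?_
  refine Reaches.head (b := (1, 1)) (by grind [tableOneII, inc]) ?_
  refine Reaches.head (b := (2, 1)) (by grind [tableOneII, inc]) ?_
  refine Reaches.trans (tableOneII_diagonal (x' := M) (y' := M - 1) (M - 2)
    (by omega) (by omega)) ?_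
  refine Reaches.head (b := (M + 2, M - 1)) (by grind (splits := 30) [tableOneII, inc]) ?_
  refine Reaches.trans (tableOneII_diagonal (x' := m - 1) (y' := m - 4) (M - 3)
    (by omega) (by omega)) ?_
  refine Reaches.head (b := (0, m - 3)) (by grind [tableOneII, inc]) ?_
  refine Reaches.head (b := (1, m - 3)) (by grind [tableOneII, inc]) ?_
  refine Reaches.head (b := (2, m - 3)) (by grind [tableOneII, inc]) ?_
  refine Reaches.head (b := (4, m - 3)) (by grind [tableOneII, inc]) ?_
  refine Reaches.head (b := (5, m - 2)) (by grind [tableOneII, inc]) ?_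
  refine Reaches.head (b := (6, m - 1)) (by grind [tableOneII, inc]) ?_
  exact Reaches.single (by grind [tableOneII, inc])

theorem tableOneII_section_reaches_even (hm10 : 10 ≤ m) (hM : m = M + M) (n u : ℕ)
    (h : u + n + 1 = M) (hu : 2 ≤ u) : Reaches (tableOneII m) (2 * u, 0) (0, 0) := by
  induction n generalizing u with
  | zero =>
    rw [show 2 * u = m - 2 by omega]
    exact tableOneII_section_neg_two hm10
  | succ n ih =>
    exact (tableOneII_section_even hM (by omega) hu).trans (ih (u + 1) (by omega) (by omega))

theorem tableOneII_section_iterate (hM : m = M + M) (n : ℕ) {u v : ℕ}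
    (hu : 1 ≤ u) (huv : u + 3 * n = v) (hv : v + 1 ≤ M) :
    Reaches (tableOneII m) (2 * u + 1, 0) (2 * v + 1, 0) := by
  induction n generalizing u with
  | zero => exact Reaches.of_eq (by rw [← huv]; rfl)
  | succ n ih =>
    exact (tableOneII_section_odd hM (by omega) hu).trans (ih (u := u + 3) (by omega) (by omega))

theorem tableOneII_section_reaches (hm10 : 10 ≤ m) (hM : m = M + M) (h4 : m % 6 = 4) (k : ℕ)
    (hk : k < m) : Reaches (tableOneII m) (k, 0) (0, 0) := by
  -- Here `M ≡ 2 (mod 3)`, so shifts by 6 lead the odd points `2u + 1` to `m - 3`, `m - 1` or `m -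
  -- 5` according to `u` modulo 3. These continue to 4, 7 and 1 respectively.
  have h1 : ∀ u, 1 ≤ u → u < M → u % 3 = 0 → Reaches (tableOneII m) (2 * u + 1, 0) (0, 0) := by
    intro u h1 hu h
    refine (tableOneII_section_iterate hM ((M - 2 - u) / 3) (v := M - 2) h1
      (by omega) (by omega)).trans ?_
    rw [show 2 * (M - 2) + 1 = m - 3 by omega]
    exact (tableOneII_section_neg_three hm10 hM).trans
      (tableOneII_section_reaches_even hm10 hM (M - 3) 2 (by omega) (by omega))
  have h3 : ∀ u, 1 ≤ u → u < M → u % 3 = 1 → Reaches (tableOneII m) (2 * u + 1, 0) (0, 0) := by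
    intro u h1' hu h
    refine (tableOneII_section_iterate hM ((M - 1 - u) / 3) (v := M - 1) h1'
      (by omega) (by omega)).trans ?_
    rw [show 2 * (M - 1) + 1 = m - 1 by omega]
    exact (tableOneII_section_neg_one hm10 hM).trans (h1 3 (by omega) (by omega) (by omega))
  have r1 : Reaches (tableOneII m) (1, 0) (0, 0) :=
    (tableOneII_section_one hm10).trans (h3 1 (by omega) (by omega) (by omega))
  have h5 : ∀ u, 1 ≤ u → u < M → u % 3 = 2 → Reaches (tableOneII m) (2 * u + 1, 0) (0, 0) := by
    intro u h1' hu h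
    refine (tableOneII_section_iterate hM ((M - 3 - u) / 3) (v := M - 3) h1'
      (by omega) (by omega)).trans ?_
    rw [show 2 * (M - 3) + 1 = m - 5 by omega]
    exact (tableOneII_section_neg_five hm10 hM).trans r1
  rcases Nat.even_or_odd' k with ⟨u, rfl | rfl⟩
  · rcases Nat.lt_or_ge u 2 with hu | hu
    · interval_cases u
      · exact Reaches.refl _ _
      · exact (tableOneII_section_two hm10 hM).trans (h5 2 (by omega) (by omega) (by omega))
    · exact tableOneII_section_reaches_even hm10 hM (M - 1 - u) u (by omega) hu
  · rcases Nat.eq_zero_or_pos u with rfl | hu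
    · exact r1
    have : u % 3 = 0 ∨ u % 3 = 1 ∨ u % 3 = 2 := by omega
    rcases this with h | h | h
    · exact h1 u hu (by omega) h
    · exact h3 u hu (by omega) h
    · exact h5 u hu (by omega) h

theorem tableOneII_reaches (hm10 : 10 ≤ m) (hm : Even m) (h4 : m % 6 = 4) (p : ℕ × ℕ)
    (hp : p.1 < m ∧ p.2 < m) : Reaches (tableOneII m) p (0, 0) := by
  obtain ⟨M, hM⟩ := hm
  -- The bonus orders the pauses of `k`; its maximum 6 explains the factor 7.
  obtain ⟨⟨i, k⟩, hq, hj, h⟩ := Reaches.exists_of_measure (f := tableOneII m)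
    (P := fun p => p.1 < m ∧ p.2 < m) (s := fun p => p.2 = 0)
    (fun p => if p.2 = 0 then 0 else 7 * (m - p.2) +
      (if p.1 = m - 1 ∧ p.2 = m - 1 then 6
      else if p.1 = 0 then 5
      else if p.1 = 1 then 4
      else if p.1 = 2 ∧ m - 2 ≤ p.2 then 3
      else if p.1 + p.2 = m - 1 then 1 else 0))
    (tableOneII_lt (by omega)) (by
      rintro ⟨j, k⟩ ⟨hj, hk⟩ hs
      simp only [tableOneII, inc] at *
      grind (splits := 30)) p hp
  refine h.trans ?_
  simp only at hj hq
  subst hj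
  exact tableOneII_section_reaches hm10 hM h4 i hq.1

end RouteE

/-! ### Color 2, both cases: the line `j = 0`. -/

namespace RouteE

variable {m M : ℕ}

theorem tableTwo_lt (hm6 : 6 ≤ m) (p : ℕ × ℕ) (hp : p.1 < m ∧ p.2 < m) :
    (tableTwo m p).1 < m ∧ (tableTwo m p).2 < m := by
  simp only [tableTwo, inc]; grind (splits := 30)

theorem tableTwo_diagonal {x y x' y' : ℕ} (n : ℕ)
    (h : x + n = x' ∧ y + n = y' ∧ x' + 1 ≤ m ∧ y' + 1 ≤ m ∧ 2 ≤ y)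
    (hs : ∀ t < n, x + y + 2 * t ≠ m) :
    Reaches (tableTwo m) (x, y) (x', y') := by
  refine Reaches.diagonal h.1 h.2.1 fun t ht => ?_
  have := hs t ht
  simp only [tableTwo, inc]
  repeat first | rw [if_pos (by omega)] | rw [if_neg (by omega)]

theorem tableTwo_section_neg_one (hm6 : 6 ≤ m) (hM : m = M + M) :
    Reaches (tableTwo m) (m - 1, 0) (m - 2, 0) := by
  refine Reaches.head (b := (m - 1, 2)) (by grind [tableTwo, inc]) ?_
  refine Reaches.head (b := (m - 1, 3)) (by grind [tableTwo, inc]) ?_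
  refine Reaches.head (b := (0, 3)) (by grind [tableTwo, inc]) ?_
  refine Reaches.trans (tableTwo_diagonal (x' := m - 4) (y' := m - 1) (m - 4)
    (by omega) (by omega)) ?_
  exact Reaches.single (by grind [tableTwo, inc])

theorem tableTwo_section_neg_two (hm6 : 6 ≤ m) (hM : m = M + M) :
    Reaches (tableTwo m) (m - 2, 0) (m - 3, 0) := by
  refine Reaches.head (b := (m - 1, 1)) (by grind [tableTwo, inc]) ?_
  refine Reaches.head (b := (0, 1)) (by grind [tableTwo, inc]) ?_
  refine Reaches.head (b := (0, 2)) (by grind [tableTwo, inc]) ?_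
  refine Reaches.trans (tableTwo_diagonal (x' := M - 1) (y' := M + 1) (M - 1)
    (by omega) (by omega)) ?_
  -- For `m = 6` the antidiagonal point is `(2, m - 2)`, where adding 2 to `j` would overshoot and
  -- the table exits at once.
  by_cases h : M = 3
  · subst h; subst hM
    exact Reaches.single rfl
  refine Reaches.head (b := (M - 1, M + 3)) (by grind [tableTwo, inc]) ?_
  refine Reaches.trans (tableTwo_diagonal (x' := m - 5) (y' := m - 1) (M - 4)
    (by omega) (by omega)) ?_
  exact Reaches.single (by grind [tableTwo, inc])

theorem tableTwo_section_odd {u : ℕ} (hM : m = M + M) (hu : u + 2 ≤ M) (hu1 : 1 ≤ u) :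
    Reaches (tableTwo m) (2 * u + 1, 0) (2 * u, 0) := by
  refine Reaches.head (b := (2 * u + 2, 1)) (by grind [tableTwo, inc]) ?_
  refine Reaches.head (b := (2 * u + 2, 2)) (by grind [tableTwo, inc]) ?_
  refine Reaches.trans (tableTwo_diagonal (x' := M + u) (y' := M - u) (M - u - 2)
    (by omega) (by omega)) ?_
  refine Reaches.head (b := (M + u, M - u + 2)) (by grind (splits := 30) [tableTwo, inc]) ?_
  refine Reaches.trans (tableTwo_diagonal (x' := m - 1) (y' := m - 2 * u + 1) (M - u - 1)
    (by omega) (by omega)) ?_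
  refine Reaches.head (b := (0, m - 2 * u + 1)) (by grind [tableTwo, inc]) ?_
  refine Reaches.trans (tableTwo_diagonal (x' := 2 * u - 2) (y' := m - 1) (2 * u - 2)
    (by omega) (by omega)) ?_
  exact Reaches.single (by grind [tableTwo, inc])

theorem tableTwo_section_even {u : ℕ} (hM : m = M + M) (hu : u + 2 ≤ M) (hu1 : 2 ≤ u) :
    Reaches (tableTwo m) (2 * u, 0) (2 * u - 1, 0) := by
  refine Reaches.head (b := (2 * u + 1, 1)) (by grind [tableTwo, inc]) ?_
  refine Reaches.head (b := (2 * u + 1, 2)) (by grind [tableTwo, inc]) ?_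
  refine Reaches.trans (tableTwo_diagonal (x' := m - 1) (y' := m - 2 * u) (m - 2 - 2 * u)
    (by omega) (by omega)) ?_
  refine Reaches.head (b := (0, m - 2 * u)) (by grind [tableTwo, inc]) ?_
  refine Reaches.trans (tableTwo_diagonal (x' := u) (y' := m - u) (u)
    (by omega) (by omega)) ?_
  by_cases h : u = 2
  · subst h
    exact Reaches.single (by grind [tableTwo, inc])
  refine Reaches.head (b := (u, m - u + 2)) (by grind [tableTwo, inc]) ?_
  refine Reaches.trans (tableTwo_diagonal (x' := 2 * u - 3) (y' := m - 1) (u - 3)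
    (by omega) (by omega)) ?_
  exact Reaches.single (by grind [tableTwo, inc])

/-- At `(1, m - 1)` the orbit wraps to `j = 1` without touching `j = 0`. This is why the lap from 2
ends at 0 and skips 1. -/
theorem tableTwo_one_neg_one (hm6 : 6 ≤ m) (hM : m = M + M) :
    Reaches (tableTwo m) (1, m - 1) (0, 0) := by
  refine Reaches.head (b := (1, 1)) (by grind [tableTwo, inc]) ?_
  refine Reaches.head (b := (1, 2)) (by grind [tableTwo, inc]) ?_
  refine Reaches.trans (tableTwo_diagonal (x' := m - 2) (y' := m - 1) (m - 3)
    (by omega) (by omega)) ?_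
  exact Reaches.single (by grind [tableTwo, inc])

theorem tableTwo_section_two (hm6 : 6 ≤ m) (hM : m = M + M) :
    Reaches (tableTwo m) (2, 0) (0, 0) := by
  refine Reaches.head (b := (3, 1)) (by grind [tableTwo, inc]) ?_
  refine Reaches.head (b := (3, 2)) (by grind [tableTwo, inc]) ?_
  refine Reaches.trans (tableTwo_diagonal (x' := m - 1) (y' := m - 2) (m - 4)
    (by omega) (by omega)) ?_
  refine Reaches.head (b := (0, m - 2)) (by grind [tableTwo, inc]) ?_
  refine Reaches.head (b := (1, m - 1)) (by grind [tableTwo, inc]) ?_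
  exact tableTwo_one_neg_one hm6 hM

/-- This lap does not meet `i = m - 1` before its end, so it misses that gain and shifts by -2
instead of -1. -/
theorem tableTwo_section_one (hm6 : 6 ≤ m) (hM : m = M + M) :
    Reaches (tableTwo m) (1, 0) (m - 1, 0) := by
  refine Reaches.head (b := (2, 1)) (by grind [tableTwo, inc]) ?_
  refine Reaches.head (b := (2, 2)) (by grind [tableTwo, inc]) ?_
  refine Reaches.trans (tableTwo_diagonal (x' := M) (y' := M) (M - 2)
    (by omega) (by omega)) ?_
  refine Reaches.head (b := (M, M + 2)) (by grind [tableTwo, inc]) ?_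
  refine Reaches.trans (tableTwo_diagonal (x' := m - 3) (y' := m - 1) (M - 3)
    (by omega) (by omega)) ?_
  exact Reaches.single (by grind [tableTwo, inc])

/-- The defects in `i` relative to `j` are -1 at `j = 1`, -2 on the antidiagonal `i + j = m`, +1 at
`i = m - 1` and +1 at the exit, in total -1. The two topmost points follow special routes with the
same outcome. -/
theorem tableTwo_section (hm6 : 6 ≤ m) (hM : m = M + M) {i : ℕ} (hi : 2 ≤ i) (him : i + 2 ≤ m) :
    Reaches (tableTwo m) (i + 1, 0) (i, 0) := by
  by_cases h1 : i = m - 2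
  · have h := tableTwo_section_neg_one hm6 hM
    rwa [show m - 1 = i + 1 by omega, ← h1] at h
  by_cases h2 : i = m - 3
  · have h := tableTwo_section_neg_two hm6 hM
    rwa [show m - 2 = i + 1 by omega, ← h2] at h
  rcases Nat.even_or_odd' i with ⟨u, rfl | rfl⟩
  · exact tableTwo_section_odd hM (by omega) (by omega)
  · exact tableTwo_section_even (u := u + 1) hM (by omega) (by omega)

theorem tableTwo_section_reaches (hm6 : 6 ≤ m) (hM : m = M + M) (i : ℕ) (hi : i < m) :
    Reaches (tableTwo m) (i, 0) (0, 0) := by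
  have h2 : ∀ n, n + 2 < m → Reaches (tableTwo m) (n + 2, 0) (0, 0) := by
    intro n
    induction n with
    | zero => exact fun _ => tableTwo_section_two hm6 hM
    | succ n ih =>
      exact fun h => (tableTwo_section hm6 hM (i := n + 2) (by omega) (by omega)).trans
        (ih (by omega))
  rcases i with _ | _ | i
  · exact Reaches.refl _ _
  · have h := h2 (m - 3) (by omega)
    rw [show m - 3 + 2 = m - 1 by omega] at h
    exact (tableTwo_section_one hm6 hM).trans h
  · exact h2 i hi

theorem tableTwo_reaches (hm6 : 6 ≤ m) (hm : Even m) (p : ℕ × ℕ)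
    (hp : p.1 < m ∧ p.2 < m) : Reaches (tableTwo m) p (0, 0) := by
  obtain ⟨M, hM⟩ := hm
  -- The point `(1, m - 1)` is added to the section because `j` drops to 1 there and the measure
  -- would grow.
  obtain ⟨⟨i, j⟩, hq, hj, h⟩ := Reaches.exists_of_measure (f := tableTwo m)
    (P := fun p => p.1 < m ∧ p.2 < m) (s := fun p => p.2 = 0 ∨ (p.1 = 1 ∧ p.2 = m - 1))
    (fun p => if p.2 = 0 then 0 else 2 * (m - p.2) + (if p.1 = m - 1 then 1 else 0))
    (tableTwo_lt hm6) (by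
      rintro ⟨j, k⟩ ⟨hj, hk⟩ hs
      simp only [tableTwo, inc] at *
      grind (splits := 30)) p hp
  refine h.trans ?_
  simp only at hj hq
  rcases hj with rfl | ⟨rfl, rfl⟩
  · exact tableTwo_section_reaches hm6 hM i hq.1
  · exact tableTwo_one_neg_one hm6 hM

end RouteE

/-! ### Injectivity of the layer-0 step. -/

namespace RouteE

variable {m : ℕ}

theorem stepZero_dirZeroI_injective (hm6 : 6 ≤ m) {x y x' y' : ℕ} (hx : x < m) (hy : y < m)
    (hx' : x' < m) (hy' : y' < m)
    (h : stepZero m (dirZeroI m x y) x y = stepZero m (dirZeroI m x' y') x' y') :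
    x = x' ∧ y = y' := by
  revert h
  unfold dirZeroI
  split_ifs with A B A' B' A' B' <;>
    simp only [stepZero, Matrix.cons_val, inc, Prod.mk.injEq] <;> grind (splits := 40)

theorem stepZero_dirZeroII_injective (hm6 : 6 ≤ m) {x y x' y' : ℕ} (hx : x < m) (hy : y < m)
    (hx' : x' < m) (hy' : y' < m)
    (h : stepZero m (dirZeroII m x y) x y = stepZero m (dirZeroII m x' y') x' y') :
    x = x' ∧ y = y' := by
  revert h
  unfold dirZeroII
  split_ifs with A B A' B' A' B' <;>
    simp only [stepZero, Matrix.cons_val, inc, Prod.mk.injEq] <;> grind (splits := 40)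

theorem stepOne_dirOneI_injective (hm6 : 6 ≤ m) {x y x' y' : ℕ} (hx : x < m) (hy : y < m)
    (hx' : x' < m) (hy' : y' < m)
    (h : stepOne m (dirOneI m x y) x y = stepOne m (dirOneI m x' y') x' y') :
    x = x' ∧ y = y' := by
  revert h
  unfold dirOneI
  split_ifs with A B A' B' A' B' <;>
    simp only [stepOne, Matrix.cons_val, inc, Prod.mk.injEq] <;> grind (splits := 40)

theorem stepOne_dirOneII_injective (hm6 : 6 ≤ m) {x y x' y' : ℕ} (hx : x < m) (hy : y < m)
    (hx' : x' < m) (hy' : y' < m)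
    (h : stepOne m (dirOneII m x y) x y = stepOne m (dirOneII m x' y') x' y') :
    x = x' ∧ y = y' := by
  revert h
  unfold dirOneII
  split_ifs with A B A' B' A' B' <;>
    simp only [stepOne, Matrix.cons_val, inc, Prod.mk.injEq] <;> grind (splits := 40)

theorem stepTwo_dirTwo_injective (hm6 : 6 ≤ m) {x y x' y' : ℕ} (hx : x < m) (hy : y < m)
    (hx' : x' < m) (hy' : y' < m)
    (h : stepTwo m (dirTwo m x y) x y = stepTwo m (dirTwo m x' y') x' y') :
    x = x' ∧ y = y' := by
  revert h
  unfold dirTwo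
  split_ifs with A B A' B' A' B' <;>
    simp only [stepTwo, Matrix.cons_val, inc, Prod.mk.injEq] <;> grind (splits := 40)

end RouteE

/-! ### Assembly for the three colors. -/

namespace RouteE

variable {m : ℕ}

theorem natCast_inj_of_lt {x y : ℕ} (hx : x < m) (hy : y < m) (h : (x : ZMod m) = y) : x = y := by
  have := congrArg ZMod.val h
  rwa [ZMod.val_cast_of_lt hx, ZMod.val_cast_of_lt hy] at this

theorem stepOne_lt (d : Fin 3) {x y : ℕ} (hx : x < m) (hy : y < m) :
    (stepOne m d x y).1 < m ∧ (stepOne m d x y).2 < m := by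
  fin_cases d <;> simp [stepOne, inc_lt, *]

/-- The color maps are injective as soon as they are injective on layer `0`. -/
theorem colorMap_injective_of_layer_zero (hm6 : 6 ≤ m) (c : Fin 3)
    (h : ∀ v w : Vertex m, layer v = 0 → layer w = 0 →
      colorMap (routeE m) c v = colorMap (routeE m) c w → v = w) :
    Function.Injective (colorMap (routeE m) c) := by
  have : Fact (1 < m) := ⟨by omega⟩
  intro v w hvw
  have hl : layer v = layer w := by
    have := congrArg layer hvw
    rwa [layer_colorMap, layer_colorMap, add_left_inj] at this
  by_cases h0 : layer v = 0
  · exact h v w h0 (hl ▸ h0) hvw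
  suffices hd : routeE m v c = routeE m w c by
    rwa [colorMap, colorMap, hd, add_left_inj] at hvw
  by_cases h1 : layer v = 1
  · rw [colorMap, colorMap] at hvw
    rw [routeE_layer_one hm6 v h1, routeE_layer_one hm6 w (hl ▸ h1)] at hvw ⊢
    -- Colors 0 and 2 move in directions 1 or 2 here and preserve `i`, so the image reveals the
    -- branch; color 1 has the same direction in both branches.
    have e := congrArg Prod.fst hvw
    split_ifs at e ⊢ with a b b
    · rfl
    · fin_cases c
      · exact absurd (by simpa [unitVec, a] using e.symm) b
      · rfl
      · exact absurd (by simpa [unitVec, a] using e.symm) b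
    · fin_cases c
      · exact absurd (by simpa [unitVec, b] using e) a
      · rfl
      · exact absurd (by simpa [unitVec, b] using e) a
    · rfl
  by_cases h2 : layer v = 2
  · rw [colorMap, colorMap] at hvw
    rw [routeE_layer_two hm6 v h2, routeE_layer_two hm6 w (hl ▸ h2)] at hvw ⊢
    -- Likewise with `j`: colors 0 and 2 use only directions 0 and 2 on layer 2.
    have e := congrArg (fun u : Vertex m => u.2.1) hvw
    split_ifs at e ⊢ with a b b
    · rfl
    · fin_cases c
      · exact absurd (by simpa [unitVec, a] using e.symm) b
      · rfl
      · exact absurd (by simpa [unitVec, a] using e.symm) b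
    · fin_cases c
      · exact absurd (by simpa [unitVec, b] using e) a
      · rfl
      · exact absurd (by simpa [unitVec, b] using e) a
    · rfl
  rw [routeE, routeE, if_neg h0, if_neg h1, if_neg h2, if_neg (hl ▸ h0), if_neg (hl ▸ h1),
    if_neg (hl ▸ h2)]

/-- A color map whose layer-`0` return map `T`, read through the charts `N` of layer `0` and `N'` of
layer `1`, has all its orbits through the origin. -/
theorem colorMap_main_of_return (hm6 : 6 ≤ m) (c : Fin 3) {N N' : ℕ × ℕ → Vertex m}
    {S T : ℕ × ℕ → ℕ × ℕ}
    (hN : ∀ v, layer v = 0 → ∃ p : ℕ × ℕ, (p.1 < m ∧ p.2 < m) ∧ v = N p)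
    (hN' : ∀ p q : ℕ × ℕ, p.1 < m ∧ p.2 < m → q.1 < m ∧ q.2 < m → N' p = N' q → p = q)
    (hS : ∀ p : ℕ × ℕ, p.1 < m ∧ p.2 < m → colorMap (routeE m) c (N p) = N' (S p))
    (hSm : ∀ p : ℕ × ℕ, p.1 < m ∧ p.2 < m → (S p).1 < m ∧ (S p).2 < m)
    (hSinj : ∀ p q : ℕ × ℕ, p.1 < m ∧ p.2 < m → q.1 < m ∧ q.2 < m → S p = S q → p = q)
    (hT : ∀ p : ℕ × ℕ, p.1 < m ∧ p.2 < m → Reaches (colorMap (routeE m) c) (N p) (N (T p)))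
    (hTm : ∀ p : ℕ × ℕ, p.1 < m ∧ p.2 < m → (T p).1 < m ∧ (T p).2 < m)
    (hT0 : ∀ p : ℕ × ℕ, p.1 < m ∧ p.2 < m → Reaches T p (0, 0)) :
    Function.Injective (colorMap (routeE m) c) ∧
      ∃ x, ∀ v, Reaches (colorMap (routeE m) c) v x := by
  have : NeZero m := ⟨by omega⟩
  refine ⟨colorMap_injective_of_layer_zero hm6 c fun v w hv hw hvw => ?_, N (0, 0), fun v => ?_⟩
  · obtain ⟨p, hp, rfl⟩ := hN v hv
    obtain ⟨q, hq, rfl⟩ := hN w hw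
    rw [hS p hp, hS q hq] at hvw
    rw [hSinj p q hp hq (hN' _ _ (hSm p hp) (hSm q hq) hvw)]
  · obtain ⟨w, hw, hvw⟩ := exists_reaches_layer_zero (routeE m) c v
    obtain ⟨p, hp, rfl⟩ := hN w hw
    exact hvw.trans (Reaches.of_simulation hTm hT hp (hT0 p hp))

theorem colorMap_zero_main (hm6 : 6 ≤ m) {D : ℕ → ℕ → Fin 3} {T : ℕ × ℕ → ℕ × ℕ}
    (hD : ∀ v : Vertex m, layer v = 0 → routeE m v 0 = D v.2.1.val v.2.2.val)
    (hT : ∀ x y, x < m → y < m →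
      returnZero m (stepZero m (D x y) x y).1 (stepZero m (D x y) x y).2 = T (x, y))
    (hTm : ∀ p : ℕ × ℕ, p.1 < m ∧ p.2 < m → (T p).1 < m ∧ (T p).2 < m)
    (hT0 : ∀ p : ℕ × ℕ, p.1 < m ∧ p.2 < m → Reaches T p (0, 0))
    (hinj : ∀ x y x' y', x < m → y < m → x' < m → y' < m →
      stepZero m (D x y) x y = stepZero m (D x' y') x' y' → x = x' ∧ y = y') :
    Function.Injective (colorMap (routeE m) 0) ∧
      ∃ x, ∀ v, Reaches (colorMap (routeE m) 0) v x := by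
  have : NeZero m := ⟨by omega⟩
  have hdir : ∀ p : ℕ × ℕ, p.1 < m ∧ p.2 < m → routeE m (nodeZero m 0 p.1 p.2) 0 = D p.1 p.2 := by
    intro p hp
    rw [hD _ (layer_nodeZero _ _ _)]
    exact congrArg₂ D (ZMod.val_cast_of_lt hp.1) (ZMod.val_cast_of_lt hp.2)
  refine colorMap_main_of_return hm6 0 (N := fun p => nodeZero m 0 p.1 p.2)
    (N' := fun p => nodeZero m 1 p.1 p.2) (S := fun p => stepZero m (D p.1 p.2) p.1 p.2)
    (fun v hv => ⟨(v.2.1.val, v.2.2.val), ⟨ZMod.val_lt _, ZMod.val_lt _⟩, exists_nodeZero hm6 v hv⟩)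
    (fun p q hp hq h => ?_) (fun p hp => colorMap_nodeZero _ _ _ (hdir p hp))
    (fun p hp => stepZero_lt _ hp.1 hp.2)
    (fun p q hp hq h => Prod.ext_iff.2 (hinj _ _ _ _ hp.1 hp.2 hq.1 hq.2 h))
    (fun p hp => reaches_nodeZero hm6 _ hp.1 hp.2 (hdir p hp) (hT _ _ hp.1 hp.2)) hTm hT0
  simp only [nodeZero, Prod.mk.injEq] at h
  exact Prod.ext (natCast_inj_of_lt hp.1 hq.1 h.2.1) (natCast_inj_of_lt hp.2 hq.2 h.2.2)

theorem colorMap_one_main (hm6 : 6 ≤ m) {D : ℕ → ℕ → Fin 3} {T : ℕ × ℕ → ℕ × ℕ}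
    (hD : ∀ v : Vertex m, layer v = 0 → routeE m v 1 = D v.1.val v.2.2.val)
    (hT : ∀ x y, x < m → y < m →
      (inc m (stepOne m (D x y) x y).1, (stepOne m (D x y) x y).2) = T (x, y))
    (hTm : ∀ p : ℕ × ℕ, p.1 < m ∧ p.2 < m → (T p).1 < m ∧ (T p).2 < m)
    (hT0 : ∀ p : ℕ × ℕ, p.1 < m ∧ p.2 < m → Reaches T p (0, 0))
    (hinj : ∀ x y x' y', x < m → y < m → x' < m → y' < m →
      stepOne m (D x y) x y = stepOne m (D x' y') x' y' → x = x' ∧ y = y') :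
    Function.Injective (colorMap (routeE m) 1) ∧
      ∃ x, ∀ v, Reaches (colorMap (routeE m) 1) v x := by
  have : NeZero m := ⟨by omega⟩
  have hdir : ∀ p : ℕ × ℕ, p.1 < m ∧ p.2 < m → routeE m (nodeOne m 0 p.1 p.2) 1 = D p.1 p.2 := by
    intro p hp
    rw [hD _ (layer_nodeOne _ _ _)]
    exact congrArg₂ D (ZMod.val_cast_of_lt hp.1) (ZMod.val_cast_of_lt hp.2)
  refine colorMap_main_of_return hm6 1 (N := fun p => nodeOne m 0 p.1 p.2)
    (N' := fun p => nodeOne m 1 p.1 p.2) (S := fun p => stepOne m (D p.1 p.2) p.1 p.2)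
    (fun v hv => ⟨(v.1.val, v.2.2.val), ⟨ZMod.val_lt _, ZMod.val_lt _⟩, exists_nodeOne hm6 v hv⟩)
    (fun p q hp hq h => ?_) (fun p hp => colorMap_nodeOne _ _ _ (hdir p hp))
    (fun p hp => stepOne_lt _ hp.1 hp.2)
    (fun p q hp hq h => Prod.ext_iff.2 (hinj _ _ _ _ hp.1 hp.2 hq.1 hq.2 h))
    (fun p hp => reaches_nodeOne hm6 _ (hdir p hp) (hT _ _ hp.1 hp.2)) hTm hT0
  simp only [nodeOne, Prod.mk.injEq] at h
  exact Prod.ext (natCast_inj_of_lt hp.1 hq.1 h.1) (natCast_inj_of_lt hp.2 hq.2 h.2.2)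

theorem colorMap_two_main (hm6 : 6 ≤ m) {D : ℕ → ℕ → Fin 3} {T : ℕ × ℕ → ℕ × ℕ}
    (hD : ∀ v : Vertex m, layer v = 0 → routeE m v 2 = D v.1.val v.2.1.val)
    (hT : ∀ x y, x < m → y < m →
      returnTwo m (stepTwo m (D x y) x y).1 (stepTwo m (D x y) x y).2 = T (x, y))
    (hTm : ∀ p : ℕ × ℕ, p.1 < m ∧ p.2 < m → (T p).1 < m ∧ (T p).2 < m)
    (hT0 : ∀ p : ℕ × ℕ, p.1 < m ∧ p.2 < m → Reaches T p (0, 0))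
    (hinj : ∀ x y x' y', x < m → y < m → x' < m → y' < m →
      stepTwo m (D x y) x y = stepTwo m (D x' y') x' y' → x = x' ∧ y = y') :
    Function.Injective (colorMap (routeE m) 2) ∧
      ∃ x, ∀ v, Reaches (colorMap (routeE m) 2) v x := by
  have : NeZero m := ⟨by omega⟩
  have hdir : ∀ p : ℕ × ℕ, p.1 < m ∧ p.2 < m → routeE m (nodeTwo m 0 p.1 p.2) 2 = D p.1 p.2 := by
    intro p hp
    rw [hD _ (layer_nodeTwo _ _ _)]
    exact congrArg₂ D (ZMod.val_cast_of_lt hp.1) (ZMod.val_cast_of_lt hp.2)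
  refine colorMap_main_of_return hm6 2 (N := fun p => nodeTwo m 0 p.1 p.2)
    (N' := fun p => nodeTwo m 1 p.1 p.2) (S := fun p => stepTwo m (D p.1 p.2) p.1 p.2)
    (fun v hv => ⟨(v.1.val, v.2.1.val), ⟨ZMod.val_lt _, ZMod.val_lt _⟩, exists_nodeTwo hm6 v hv⟩)
    (fun p q hp hq h => ?_) (fun p hp => colorMap_nodeTwo _ _ _ (hdir p hp))
    (fun p hp => stepTwo_lt _ hp.1 hp.2)
    (fun p q hp hq h => Prod.ext_iff.2 (hinj _ _ _ _ hp.1 hp.2 hq.1 hq.2 h))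
    (fun p hp => reaches_nodeTwo hm6 _ hp.1 hp.2 (hdir p hp) (hT _ _ hp.1 hp.2)) hTm hT0
  simp only [nodeTwo, Prod.mk.injEq] at h
  exact Prod.ext (natCast_inj_of_lt hp.1 hq.1 h.1) (natCast_inj_of_lt hp.2 hq.2 h.2.1)

/-- Each color map is injective and all its orbits reach a common vertex. -/
theorem colorMap_main (hm6 : 6 ≤ m) (hm : Even m) (c : Fin 3) :
    Function.Injective (colorMap (routeE m) c) ∧
      ∃ x, ∀ v, Reaches (colorMap (routeE m) c) v x := by
  by_cases h4 : m % 6 = 4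
  · have h10 : 10 ≤ m := by omega
    have hD := routeE_layer_zero_of_eq hm6 h4
    fin_cases c
    · exact colorMap_zero_main hm6 (fun v hv => (hD v hv).1)
        (fun _ _ => return_dirZeroII hm6 h4) (tableZeroII_lt hm6) (tableZeroII_reaches h10 hm)
        (fun _ _ _ _ => stepZero_dirZeroII_injective hm6)
    · exact colorMap_one_main hm6 (fun v hv => (hD v hv).2.1)
        (fun _ _ => return_dirOneII hm6 h4) (tableOneII_lt hm6) (tableOneII_reaches h10 hm h4)
        (fun _ _ _ _ => stepOne_dirOneII_injective hm6)
    · exact colorMap_two_main hm6 (fun v hv => (hD v hv).2.2)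
        (fun _ _ => return_dirTwo hm6) (tableTwo_lt hm6) (tableTwo_reaches hm6 hm)
        (fun _ _ _ _ => stepTwo_dirTwo_injective hm6)
  · have hD := routeE_layer_zero_of_ne hm6 h4
    fin_cases c
    · exact colorMap_zero_main hm6 (fun v hv => (hD v hv).1)
        (fun _ _ => return_dirZeroI hm6) (tableZeroI_lt hm6) (tableZeroI_reaches hm6 hm)
        (fun _ _ _ _ => stepZero_dirZeroI_injective hm6)
    · exact colorMap_one_main hm6 (fun v hv => (hD v hv).2.1)
        (fun _ _ => return_dirOneI hm6) (tableOneI_lt hm6) (tableOneI_reaches hm6 hm h4)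
        (fun _ _ _ _ => stepOne_dirOneI_injective hm6)
    · exact colorMap_two_main hm6 (fun v hv => (hD v hv).2.2)
        (fun _ _ => return_dirTwo hm6) (tableTwo_lt hm6) (tableTwo_reaches hm6 hm)
        (fun _ _ _ _ => stepTwo_dirTwo_injective hm6)

end RouteE

theorem isDirectionAssignment_routeE (m : ℕ) : IsDirectionAssignment (routeE m) := by
  intro v
  unfold routeE RouteE.layerZeroI RouteE.layerZeroII
  split_ifs <;> decide

theorem mainTheorem2 (m : ℕ) (hm : Even m) (hm6 : 6 ≤ m) :
    IsColoring (routeE m) ∧ ∀ c : Fin 3, IsDirectedHamiltonCycle (colorClass (routeE m) c) := by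
  have : NeZero m := ⟨by omega⟩
  refine ⟨⟨isDirectionAssignment_routeE m, fun c =>
    Finite.injective_iff_bijective.1 (RouteE.colorMap_main hm6 hm c).1⟩, fun c => ?_⟩
  obtain ⟨hinj, x, hx⟩ := RouteE.colorMap_main hm6 hm c
  exact isDirectedHamiltonCycle_of_reaches (by omega) (routeE m) c hinj x hx
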